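/- Let $p,q,e$ be integers with $0<p<q$ and $\gcd(p,q)=1$, and let $w=(e-1)q-p$. Let $L=L(1/2,1/2,p/q;e)$ be the $(2,2,r)$-Montesinos link: the closure of a row consisting of two rational tangles of fraction $1/2$, one rational tangle of fraction $p/q$, and $|e|$ half-twists, where the sign of the half-twists is such that replacing the fraction $r$ of one of the tangles by $r+1$ and $e$ by $e+1$ does not change the link. Let $Q_2(L)$ be the involutory quandle of $L$, presented from a diagram of $L$ as follows: there is one generator for each arc of the diagram, and at each crossing with over-arc $x_j$ and under-arcs $x_i,x_k$ there is the relation $x_k\rhd x_j=x_i$. The presentation is taken among quandles in which $(x\rhd y)\rhd y=x$ for all $x,y$. Let $\mathrm{Aut}(Q_2(L))$ be the group of bijections $\phi$ of $Q_2(L)$ with $\phi(x\rhd y)=\phi(x)\rhd\phi(y)$ for all $x,y$. Then $\mathrm{Aut}(Q_2(L))$ is finite, and $$|\mathrm{Aut}(Q_2(L))|\le\begin{cases}24\,w^2\,\Phi(4|w|)&\text{if } q=2,\\ 4q\,w^2\,\Phi(2q|w|)&\text{if } q>2,\end{cases}$$ where $\Phi$ is Euler's totient function. -/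

import Mathlib

open scoped Quandles

/-! ### Diagrams

A diagram is cut at its crossings (and possibly at further points of its strands) into edges.
A crossing lists the four edges that meet there in counterclockwise order, starting from one end
of the under-strand (a planar diagram code).  A join is a pair of edges that are glued end to end,
without a crossing.  -/

/-- A crossing, its four edges in counterclockwise order: the under-strand consists of `under₁`
and `under₂`, the over-strand of `over₁` and `over₂`. -/
structure Crossing (E : Type) where
  under₁ : E
  over₁ : E
  under₂ : E
  over₂ : E

/-- The same crossing, with renamed edges. -/
def Crossing.map {E F : Type} (f : E → F) (c : Crossing E) : Crossing F :=
  ⟨f c.under₁, f c.over₁, f c.under₂, f c.over₂⟩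

/-- A planar diagram code of an unoriented link. -/
structure LinkDiagram where
  Edge : Type
  crossings : List (Crossing Edge)
  joins : List (Edge × Edge)

/-- A planar diagram code of a tangle in a disc with four boundary points, with the edges that end
at the upper left, upper right, lower left and lower right boundary point. -/
structure TangleDiagram where
  Edge : Type
  crossings : List (Crossing Edge)
  joins : List (Edge × Edge)
  nw : Edge
  ne : Edge
  sw : Edge
  se : Edge

namespace TangleDiagram

/-- Two horizontal strands without a crossing; the upper one is `false`. -/
def zero : TangleDiagram where
  Edge := Bool
  crossings := []
  joins := []
  nw := false
  ne := false
  sw := true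
  se := true

/-- One crossing, whose over-strand runs from lower left to upper right. The edges
`0, 1, 2, 3` end at the upper left, upper right, lower left, lower right point. -/
def one : TangleDiagram where
  Edge := Fin 4
  crossings := [⟨0, 2, 3, 1⟩]
  joins := []
  nw := 0
  ne := 1
  sw := 2
  se := 3

/-- One crossing, whose over-strand runs from upper left to lower right. -/
def negOne : TangleDiagram where
  Edge := Fin 4
  crossings := [⟨1, 0, 2, 3⟩]
  joins := []
  nw := 0
  ne := 1
  sw := 2
  se := 3

/-- The tangle sum: `T` is placed to the right of `S`. -/
def add (S T : TangleDiagram) : TangleDiagram where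
  Edge := S.Edge ⊕ T.Edge
  crossings := S.crossings.map (Crossing.map Sum.inl) ++ T.crossings.map (Crossing.map Sum.inr)
  joins := S.joins.map (Prod.map Sum.inl Sum.inl) ++ T.joins.map (Prod.map Sum.inr Sum.inr) ++
    [(Sum.inl S.ne, Sum.inr T.nw), (Sum.inl S.se, Sum.inr T.sw)]
  nw := Sum.inl S.nw
  ne := Sum.inr T.ne
  sw := Sum.inl S.sw
  se := Sum.inr T.se

/-- The counterclockwise rotation by a quarter turn. -/
def rot (T : TangleDiagram) : TangleDiagram where
  Edge := T.Edge
  crossings := T.crossings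
  joins := T.joins
  nw := T.ne
  ne := T.se
  sw := T.nw
  se := T.sw

/-- A row of `|n|` half-twists of two horizontal strands, with crossings `one` if `n > 0` and
`negOne` if `n < 0`. -/
def twist : ℤ → TangleDiagram
  | Int.ofNat n => (fun T => T.add one)^[n] zero
  | Int.negSucc n => (fun T => T.add negOne)^[n + 1] zero

/-- The closure of a tangle that joins the two upper boundary points outside the disc, and the
two lower ones. -/
def closure (T : TangleDiagram) : LinkDiagram where
  Edge := T.Edge
  crossings := T.crossings
  joins := T.joins ++ [(T.nw, T.ne), (T.sw, T.se)]

end TangleDiagram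

/-- The ways to build a rational tangle: start from two horizontal strands, add half-twists on the
right, and rotate by a quarter turn. -/
inductive RationalTangle : Type
  | zero : RationalTangle
  | addOne : RationalTangle → RationalTangle
  | subOne : RationalTangle → RationalTangle
  | rot : RationalTangle → RationalTangle

namespace RationalTangle

/-- The diagram that is built. -/
def diagram : RationalTangle → TangleDiagram
  | zero => TangleDiagram.zero
  | addOne t => t.diagram.add TangleDiagram.one
  | subOne t => t.diagram.add TangleDiagram.negOne
  | rot t => t.diagram.rot

/-- Numerator and denominator of the fraction of a rational tangle, an element of
`ℚ ∪ {1 / 0}`: a half-twist adds `1` or `-1` to the fraction `r`, a quarter turn changes `r` to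
`-1 / r`. -/
def frac : RationalTangle → ℤ × ℤ
  | zero => (0, 1)
  | addOne t => (t.frac.1 + t.frac.2, t.frac.2)
  | subOne t => (t.frac.1 - t.frac.2, t.frac.2)
  | rot t => (-t.frac.2, t.frac.1)

/-- The fraction of the rational tangle `t` is `p / q`. -/
def HasFraction (t : RationalTangle) (p q : ℤ) : Prop :=
  t.frac.1 * q = p * t.frac.2

theorem isCoprime_frac (t : RationalTangle) : IsCoprime t.frac.1 t.frac.2 := by
  induction t with
  | zero => exact isCoprime_zero_left.mpr isUnit_one
  | addOne t ih => simpa [frac] using ih.add_mul_left_left 1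
  | subOne t ih =>
    have h := ih.add_mul_left_left (-1)
    simpa [frac, sub_eq_add_neg] using h
  | rot t ih => exact (IsCoprime.neg_left ih.symm)

/-- Every fraction in lowest terms belongs to a rational tangle. -/
theorem exists_hasFraction (p q : ℤ) (h : IsCoprime p q) :
    ∃ t : RationalTangle, t.HasFraction p q := by
  have shift : ∀ (k : ℤ) (t : RationalTangle),
      ∃ s : RationalTangle, s.frac = (t.frac.1 + k * t.frac.2, t.frac.2) := by
    intro k t
    induction k with
    | zero => exact ⟨t, by simp⟩
    | succ i ih =>
      obtain ⟨s, hs⟩ := ih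
      exact ⟨s.addOne, by simp [frac, hs]; ring⟩
    | pred i ih =>
      obtain ⟨s, hs⟩ := ih
      exact ⟨s.subOne, by simp [frac, hs]; ring⟩
  induction hn : q.natAbs using Nat.strong_induction_on generalizing p q with
  | _ n ih =>
    by_cases hq : q = 0
    · exact ⟨zero.rot, by simp [HasFraction, frac, hq]⟩
    · have hlt : (p % q).natAbs < n := by
        have h1 := Int.emod_nonneg p hq
        have h2 := Int.emod_lt_abs p hq
        rw [← hn]
        zify
        rwa [abs_of_nonneg h1]
      have hc : IsCoprime (-q) (p % q) := by
        have h3 : IsCoprime (p % q) q := by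
          have h4 := h.add_mul_left_left (-(p / q))
          have h5 : p + q * -(p / q) = p % q := by
            have := Int.emod_add_mul_ediv p q
            linarith
          rwa [h5] at h4
        exact h3.symm.neg_left
      obtain ⟨t, ht⟩ := ih _ hlt (-q) (p % q) hc rfl
      obtain ⟨s, hs⟩ := shift (p / q) t.rot
      refine ⟨s, ?_⟩
      have h6 := Int.emod_add_mul_ediv p q
      simp only [HasFraction, frac, hs] at ht ⊢
      linear_combination -ht + t.frac.1 * h6

end RationalTangle

/-- The standard diagram of the Montesinos link with the rational tangles `t₁`, `t₂`, `t₃`, side by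
side, and `e` half-twists: it is closed up with `|e|` crossings, of the sign for which the link
does not change when the fraction of a `tᵢ` and the integer `e` are both increased by `1`. -/
def montesinosDiagram (t₁ t₂ t₃ : RationalTangle) (e : ℤ) : LinkDiagram :=
  (((t₁.diagram.add t₂.diagram).add t₃.diagram).add (TangleDiagram.twist (-e))).closure

/-! ### The involutory quandle of a link -/

/-- The congruence on formal products which is generated by the relations `r` and the axioms of an
involutory quandle. A product `x * y` stands for `x ▷ y`, so that `y` acts on `x`. -/
inductive InvQuandleRel {E : Type} (r : FreeMagma E → FreeMagma E → Prop) :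
    FreeMagma E → FreeMagma E → Prop
  | of {x y} : r x y → InvQuandleRel r x y
  | refl (x) : InvQuandleRel r x x
  | symm {x y} : InvQuandleRel r x y → InvQuandleRel r y x
  | trans {x y z} : InvQuandleRel r x y → InvQuandleRel r y z → InvQuandleRel r x z
  | mul {x x' y y'} : InvQuandleRel r x x' → InvQuandleRel r y y' →
      InvQuandleRel r (x * y) (x' * y')
  | idem (x) : InvQuandleRel r (x * x) x
  | invol (x y) : InvQuandleRel r ((x * y) * y) x
  | distrib (x y z) : InvQuandleRel r ((x * y) * z) ((x * z) * (y * z))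

/-- The congruence of `InvQuandleRel` as a setoid. -/
def invQuandleSetoid {E : Type} (r : FreeMagma E → FreeMagma E → Prop) : Setoid (FreeMagma E) where
  r := InvQuandleRel r
  iseqv := ⟨.refl, .symm, .trans⟩

/-- The involutory quandle with generators `E` and relations `r`. -/
def PresentedInvQuandle {E : Type} (r : FreeMagma E → FreeMagma E → Prop) : Type :=
  Quotient (invQuandleSetoid r)

namespace PresentedInvQuandle

variable {E : Type} (r : FreeMagma E → FreeMagma E → Prop)

/-- The operation `x ▷ y`. -/
def op : PresentedInvQuandle r → PresentedInvQuandle r → PresentedInvQuandle r :=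
  Quotient.map₂ (· * ·) fun _ _ hx _ _ hy => InvQuandleRel.mul hx hy

theorem op_op (x y : PresentedInvQuandle r) : op r (op r x y) y = x :=
  Quotient.inductionOn₂ x y fun a b => Quotient.sound (InvQuandleRel.invol a b)

/-- In Mathlib's notation `y ◃ x`, the element that acts stands on the left. -/
instance : Quandle (PresentedInvQuandle r) where
  act y x := op r x y
  invAct y x := op r x y
  self_distrib {z y x} :=
    Quotient.inductionOn₃ x y z fun a b c => Quotient.sound (InvQuandleRel.distrib a b c)
  left_inv y x := op_op r x y
  right_inv y x := op_op r x y
  fix {x} := Quotient.inductionOn x fun a => Quotient.sound (InvQuandleRel.idem a)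

theorem isInvolutory : Rack.IsInvolutory (PresentedInvQuandle r) := fun y x => op_op r x y

end PresentedInvQuandle

namespace LinkDiagram

/-- The relations of a diagram: the edges of an over-strand agree, the edge on one side of the
under-strand is obtained from the edge on the other side by the action of the over-strand, and edges
that are joined agree. -/
inductive QuandleRel (D : LinkDiagram) : FreeMagma D.Edge → FreeMagma D.Edge → Prop
  | over (c) : c ∈ D.crossings → QuandleRel D (.of c.over₁) (.of c.over₂)
  | under (c) : c ∈ D.crossings → QuandleRel D (.of c.under₁ * .of c.over₁) (.of c.under₂)
  | join (a b) : (a, b) ∈ D.joins → QuandleRel D (.of a) (.of b)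

/-- The involutory quandle `Q₂` of the link with the diagram `D`. -/
abbrev InvolutoryQuandle (D : LinkDiagram) : Type :=
  PresentedInvQuandle D.QuandleRel

end LinkDiagram

/-- The automorphism group of a quandle: the bijections that respect the operation. -/
def quandleAut (Q : Type) [Quandle Q] : Subgroup (Equiv.Perm Q) where
  carrier := {φ | ∀ x y : Q, φ (x ◃ y) = φ x ◃ φ y}
  mul_mem' := fun {f g} hf hg x y => by
    rw [Equiv.Perm.mul_apply, hg, hf, Equiv.Perm.mul_apply, Equiv.Perm.mul_apply]
  one_mem' := fun _ _ => rfl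
  inv_mem' := fun {f} hf x y => by
    rw [Equiv.Perm.inv_eq_iff_eq, hf]
    simp

/-! A rational tangle contributes a single dihedral sequence: every colouring of it is an integer
labelling followed by a sequence `x` with `x j ◃ x i = x (2 * j - i)`, and the fraction fixes the
labels at the four corners (`RationalTangle.HasFraction.hasLabelling`). Gluing the tangles therefore
leaves a short presentation (`exists_isMontesinosSystem`): the dihedral sequence `z` of the tangle
`p / q`, one element `α` shared by the two tangles `1 / 2`, and three relations.

Let `T` be the translation `z i ↦ z (i - 2)` and `σ` the action of `α`. The relations say that `σ`
commutes with `T ^ w`, inverts `T ^ q`, and that `T ^ w` fixes `α`. Since `c * q - a * w = 1` for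
suitable `a`, `c`, this determines `σ` on all powers of `T`. It also forces `z` to have period `2 *
q * w` (`z_add_period`), while `z k ◃ α` depends only on `k` modulo `w`. So the quandle consists of
at most `2 * q * |w|` elements `z i` and at most `2 * |w|` conjugates of `α` (`exhaustion`). An
explicit quandle on `ZMod (2 * q * W) ⊕ ZMod (2 * W)` with `W = |w|` satisfies the relations and has
exactly this size, so it is the quandle of the link (`IsMontesinosSystem.bijective`).

An automorphism that preserves the small summand is determined by the images of `a 0`, `z 0` and `z
1`; the last two differ by a unit, which produces the totient. If `q > 2`, the orders of
translations show that every automorphism preserves the small summand. If `q = 2`, it could be moved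
to the even or odd half of the large summand, whence a factor of at most `3`. -/

/-! ### Dihedral sequences in involutory quandles -/

/-- A sequence on which the quandle acts by reflections of the index. -/
def IsDihedralSeq {X : Type} [Quandle X] (x : ℤ → X) : Prop :=
  ∀ i j, x j ◃ x i = x (2 * j - i)

theorem IsDihedralSeq.comp_affine {X : Type} [Quandle X] {x : ℤ → X} (hx : IsDihedralSeq x)
    (m b : ℤ) : IsDihedralSeq fun i => x (m * i + b) := by
  intro i j
  rw [hx]
  congr 1
  ring

section Involutory

variable {X : Type} [Quandle X]

theorem Rack.act'_mul_self (hX : Rack.IsInvolutory X) (a : X) :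
    Rack.act' a * Rack.act' a = 1 := by
  ext y
  exact hX a y

theorem Rack.act'_inv (hX : Rack.IsInvolutory X) (a : X) :
    (Rack.act' a)⁻¹ = Rack.act' a :=
  inv_eq_of_mul_eq_one_left (Rack.act'_mul_self hX a)

theorem Rack.act'_act (hX : Rack.IsInvolutory X) (a b : X) :
    Rack.act' (a ◃ b) = Rack.act' a * Rack.act' b * Rack.act' a := by
  rw [Rack.ad_conj, Rack.act'_inv hX]

/-- If `s` is an involution that inverts `g`, it inverts the powers of `g`. -/
theorem conj_zpow_of_conj_eq_inv {G : Type*} [Group G] {s g : G} (hs : s * s = 1)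
    (h : s * g * s = g⁻¹) (k : ℤ) : s * g ^ k = g ^ (-k) * s := by
  have hinv : s⁻¹ = s := inv_eq_of_mul_eq_one_left hs
  have : s * g ^ k * s⁻¹ = g ^ (-k) := by
    rw [← conj_zpow, hinv, h, inv_zpow, zpow_neg]
  rw [← this, inv_mul_cancel_right]

/-- Two elements of an involutory quandle are consecutive terms of a dihedral sequence. -/
theorem exists_isDihedralSeq (hX : Rack.IsInvolutory X) (a b : X) :
    ∃ x : ℤ → X, IsDihedralSeq x ∧ x 0 = a ∧ x 1 = b := by
  set S := Rack.act' a with hS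
  set R := Rack.act' b with hR
  have hSS : S * S = 1 := Rack.act'_mul_self hX a
  have hRR : R * R = 1 := Rack.act'_mul_self hX b
  have hSa : S a = a := Quandle.fix
  have hRb : R b = b := Quandle.fix
  have hSi : S⁻¹ = S := inv_eq_of_mul_eq_one_left hSS
  have hRi : R⁻¹ = R := inv_eq_of_mul_eq_one_left hRR
  set T := R * S with hT
  have hTi : T⁻¹ = S * R := by rw [hT, mul_inv_rev, hSi, hRi]
  have hST : ∀ k : ℤ, S * T ^ k = T ^ (-k) * S :=
    conj_zpow_of_conj_eq_inv hSS (by rw [hTi, hT, mul_assoc, mul_assoc, hSS, mul_one])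
  have hRT : ∀ k : ℤ, R * T ^ k = T ^ (-k) * R :=
    conj_zpow_of_conj_eq_inv hRR (by rw [hTi, hT, ← mul_assoc, hRR, one_mul])
  have hSb : S b = (T ^ (-1 : ℤ)) b := by
    rw [zpow_neg_one, hTi, Equiv.Perm.mul_apply, hRb]
  have hRa : R a = (T ^ (1 : ℤ)) a := by
    rw [zpow_one, hT, Equiv.Perm.mul_apply, hSa]
  -- `T` is the product of the reflections in terms 0 and 1, hence shifts the index by 2: the even
  -- terms are the `T`-orbit of `a`, the odd ones that of `b`.
  let x : ℤ → X := fun i => if Even i then (T ^ (i / 2)) a else (T ^ (i / 2)) b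
  have hx0 : ∀ k : ℤ, x (2 * k) = (T ^ k) a := fun k => by simp [x]
  have hx1 : ∀ k : ℤ, x (2 * k + 1) = (T ^ k) b := fun k => by
    have : (2 * k + 1) / 2 = k := by omega
    simp [x, this]
  have equivariant : ∀ (k : ℤ) y z, (T ^ k) y ◃ z = (T ^ k) (y ◃ (T ^ (-k)) z) := by
    have one : ∀ c y z : X, Rack.act' c (y ◃ z) = Rack.act' c y ◃ Rack.act' c z :=
      fun c y z => Shelf.self_distrib
    let H : Subgroup (Equiv.Perm X) := quandleAut X
    have hTH : T ∈ H := H.mul_mem (one b) (one a)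
    intro k y z
    have := (H.zpow_mem hTH k) y ((T ^ (-k)) z)
    rw [this, ← Equiv.Perm.mul_apply, ← zpow_add, add_neg_cancel, zpow_zero, Equiv.Perm.one_apply]
  -- The action of `T ^ j c` is the conjugate `T ^ j * U * T ^ (-j)`, with `U` the action of `c`;
  -- since `U` inverts `T`, it reflects the exponent in `j`.
  have key : ∀ (U : Equiv.Perm X), (∀ k : ℤ, U * T ^ k = T ^ (-k) * U) → ∀ (j i : ℤ) (y : X),
      (T ^ j) (U ((T ^ (-j)) ((T ^ i) y))) = (T ^ (2 * j - i)) (U y) := by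
    intro U hU j i y
    have h : T ^ j * (U * (T ^ (-j) * T ^ i)) = T ^ (2 * j - i) * U := by
      rw [← zpow_add, hU, ← mul_assoc, ← zpow_add]
      congr 2
      ring
    exact DFunLike.congr_fun h y
  refine ⟨x, ?_, by simpa using hx0 0, by simpa using hx1 0⟩
  intro i j
  obtain ⟨k, rfl | rfl⟩ := Int.even_or_odd' i <;> obtain ⟨l, rfl | rfl⟩ := Int.even_or_odd' j
  · rw [hx0, hx0, equivariant]
    rw [show 2 * (2 * l) - 2 * k = 2 * (2 * l - k) by ring, hx0]
    exact (key S hST l k a).trans (by rw [hSa])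
  · rw [hx0, hx1, equivariant]
    rw [show 2 * (2 * l + 1) - 2 * k = 2 * (2 * l - k + 1) by ring, hx0]
    exact (key R hRT l k a).trans (by rw [hRa, ← Equiv.Perm.mul_apply, ← zpow_add])
  · rw [hx1, hx0, equivariant]
    rw [show 2 * (2 * l) - (2 * k + 1) = 2 * (2 * l - k - 1) + 1 by ring, hx1]
    exact (key S hST l k b).trans (by rw [hSb, ← Equiv.Perm.mul_apply, ← zpow_add]; rfl)
  · rw [hx1, hx1, equivariant]
    rw [show 2 * (2 * l + 1) - (2 * k + 1) = 2 * (2 * l - k) + 1 by ring, hx1]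
    exact (key R hRT l k b).trans (by rw [hRb])

end Involutory

/-! ### Colourings of diagrams -/

/-- An assignment of colours to edges that satisfies the relations of a diagram. -/
structure IsColoring {E X : Type} (act : X → X → X) (crossings : List (Crossing E))
    (joins : List (E × E)) (C : E → X) : Prop where
  over_eq : ∀ c ∈ crossings, C c.over₁ = C c.over₂
  under_eq : ∀ c ∈ crossings, act (C c.over₁) (C c.under₁) = C c.under₂
  join_eq : ∀ a b, (a, b) ∈ joins → C a = C b

namespace IsColoring

variable {E X : Type} {cr : List (Crossing E)} {jn : List (E × E)}

theorem map {Y : Type} {act : X → X → X} {act' : Y → Y → Y} {C : E → X}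
    (h : IsColoring act cr jn C) (f : X → Y) (hf : ∀ a b, act' (f a) (f b) = f (act a b)) :
    IsColoring act' cr jn fun e => f (C e) where
  over_eq c hc := congrArg f (h.over_eq c hc)
  under_eq c hc := by rw [hf, h.under_eq c hc]
  join_eq a b hab := congrArg f (h.join_eq a b hab)

theorem of_add {act : X → X → X} {S T : TangleDiagram} {C : (S.add T).Edge → X}
    (h : IsColoring act (S.add T).crossings (S.add T).joins C) :
    IsColoring act S.crossings S.joins (fun e => C (Sum.inl e)) ∧
    IsColoring act T.crossings T.joins (fun e => C (Sum.inr e)) ∧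
    C (Sum.inl S.ne) = C (Sum.inr T.nw) ∧ C (Sum.inl S.se) = C (Sum.inr T.sw) := by
  refine ⟨⟨fun c hc => ?_, fun c hc => ?_, fun a b hab => ?_⟩,
    ⟨fun c hc => ?_, fun c hc => ?_, fun a b hab => ?_⟩, ?_, ?_⟩
  · exact h.over_eq (c.map Sum.inl) (List.mem_append_left _ (List.mem_map_of_mem hc))
  · exact h.under_eq (c.map Sum.inl) (List.mem_append_left _ (List.mem_map_of_mem hc))
  · exact h.join_eq _ _ (List.mem_append_left _ (List.mem_append_left _
      (List.mem_map_of_mem (f := Prod.map Sum.inl Sum.inl) hab)))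
  · exact h.over_eq (c.map Sum.inr) (List.mem_append_right _ (List.mem_map_of_mem hc))
  · exact h.under_eq (c.map Sum.inr) (List.mem_append_right _ (List.mem_map_of_mem hc))
  · exact h.join_eq _ _ (List.mem_append_left _ (List.mem_append_right _
      (List.mem_map_of_mem (f := Prod.map Sum.inr Sum.inr) hab)))
  · exact h.join_eq _ _ (List.mem_append_right _ List.mem_cons_self)
  · exact h.join_eq _ _ (List.mem_append_right _ (List.mem_cons_of_mem _ List.mem_cons_self))

theorem add {act : X → X → X} {S T : TangleDiagram} {C : S.Edge → X} {C' : T.Edge → X}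
    (h : IsColoring act S.crossings S.joins C) (h' : IsColoring act T.crossings T.joins C')
    (hn : C S.ne = C' T.nw) (hs : C S.se = C' T.sw) :
    IsColoring act (S.add T).crossings (S.add T).joins (Sum.elim C C') := by
  refine ⟨fun c hc => ?_, fun c hc => ?_, fun a b hab => ?_⟩
  · rcases List.mem_append.1 hc with hc | hc <;> obtain ⟨c, hc', rfl⟩ := List.mem_map.1 hc
    · exact h.over_eq c hc'
    · exact h'.over_eq c hc'
  · rcases List.mem_append.1 hc with hc | hc <;> obtain ⟨c, hc', rfl⟩ := List.mem_map.1 hc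
    · exact h.under_eq c hc'
    · exact h'.under_eq c hc'
  · rcases List.mem_append.1 hab with hab | hab
    · rcases List.mem_append.1 hab with hab | hab <;>
        obtain ⟨⟨a', b'⟩, hab', heq⟩ := List.mem_map.1 hab <;>
        obtain ⟨rfl, rfl⟩ := Prod.mk.inj heq
      · exact h.join_eq _ _ hab'
      · exact h'.join_eq _ _ hab'
    · rcases List.mem_cons.1 hab with heq | hab
      · obtain ⟨rfl, rfl⟩ := Prod.mk.inj heq
        exact hn
      · obtain ⟨rfl, rfl⟩ := Prod.mk.inj (List.mem_singleton.1 hab)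
        exact hs

end IsColoring

/-! ### Integer labellings of rational tangles -/

namespace TangleDiagram

/-- The integral labelling `ℓ` of the edges of `T` is the universal colouring of `T`, with the
boundary values of a rational tangle of fraction `n / d`. -/
structure IsLabelling (T : TangleDiagram) (n d : ℤ) (ℓ : T.Edge → ℤ) : Prop where
  nw : ℓ T.nw = 0
  ne : ℓ T.ne = n
  sw : ℓ T.sw = d
  se : ℓ T.se = n + d
  coloring : IsColoring (fun j i => 2 * j - i) T.crossings T.joins ℓ
  exists_seq : ∀ (X : Type) [Quandle X], Rack.IsInvolutory X → ∀ C : T.Edge → X,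
    IsColoring Shelf.act T.crossings T.joins C →
      ∃ x : ℤ → X, IsDihedralSeq x ∧ ∀ e, C e = x (ℓ e)

/-- The tangle `T` has a labelling with the boundary values of the fraction `n / d`. -/
def HasLabelling (T : TangleDiagram) (n d : ℤ) : Prop :=
  ∃ ℓ, T.IsLabelling n d ℓ

namespace HasLabelling

theorem zero : TangleDiagram.zero.HasLabelling 0 1 := by
  refine ⟨fun b => cond b 1 0, rfl, rfl, rfl, rfl, ⟨?_, ?_, ?_⟩, ?_⟩
  · intro c hc; cases hc
  · intro c hc; cases hc
  · intro a b hab; cases hab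
  · intro X _ hX C _
    obtain ⟨x, hx, h0, h1⟩ := exists_isDihedralSeq hX (C false) (C true)
    refine ⟨x, hx, fun e => ?_⟩
    cases e
    · exact h0.symm
    · exact h1.symm

/-- Needed because a fraction fixes numerator and denominator only up to a common sign. -/
theorem neg {T : TangleDiagram} {n d : ℤ} (h : T.HasLabelling n d) : T.HasLabelling (-n) (-d) := by
  obtain ⟨ℓ, h⟩ := h
  refine ⟨fun e => -ℓ e, by simp [h.nw], by simp [h.ne], by simp [h.sw], by simp [h.se]; ring,
    h.coloring.map _ fun a b => by ring, fun X _ hX C hC => ?_⟩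
  obtain ⟨x, hx, hCx⟩ := h.exists_seq X hX C hC
  exact ⟨_, hx.comp_affine (-1) 0, fun e => by simp [hCx]⟩

theorem rot {T : TangleDiagram} {n d : ℤ} (h : T.HasLabelling n d) :
    T.rot.HasLabelling (-d) n := by
  obtain ⟨ℓ, h⟩ := h
  -- The new upper left corner is the old upper right one, with label `n`; the reflection `i ↦ n -
  -- i` brings it back to `0`.
  refine ⟨fun e => n - ℓ e, ?_, ?_, ?_, ?_, ?_, fun X _ hX C hC => ?_⟩
  · exact (congrArg (n - ·) h.ne).trans (by ring)
  · exact (congrArg (n - ·) h.se).trans (by ring)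
  · exact (congrArg (n - ·) h.nw).trans (by ring)
  · exact (congrArg (n - ·) h.sw).trans (by ring)
  · exact h.coloring.map (n - ·) fun a b => by ring
  · obtain ⟨x, hx, hCx⟩ := h.exists_seq X hX C hC
    exact ⟨_, hx.comp_affine (-1) n, fun e => (hCx e).trans <| by
      congr 1
      ring⟩

theorem add_one {T : TangleDiagram} {n d : ℤ} (h : T.HasLabelling n d) :
    (T.add one).HasLabelling (n + d) d := by
  obtain ⟨ℓ, h⟩ := h
  -- The over-strand carries `n + d`; the lower right label is the reflection of `n` in it.
  refine ⟨Sum.elim ℓ ![n, n + d, n + d, n + 2 * d], h.nw, rfl, h.sw, ?_,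
    h.coloring.add ⟨?_, ?_, ?_⟩ h.ne h.se, fun X _ hX C hC => ?_⟩
  · change n + 2 * d = n + d + d
    ring
  · intro c hc
    obtain rfl := List.mem_singleton.1 hc
    rfl
  · intro c hc
    obtain rfl := List.mem_singleton.1 hc
    change 2 * (n + d) - n = n + 2 * d
    ring
  · intro a b hab
    cases hab
  · obtain ⟨hS, hT, hn, hs⟩ := hC.of_add
    obtain ⟨x, hx, hCx⟩ := h.exists_seq X hX _ hS
    have ho := hT.over_eq _ (List.mem_singleton_self _)
    have hu := hT.under_eq _ (List.mem_singleton_self _)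
    change C (Sum.inr (2 : Fin 4)) = C (Sum.inr (1 : Fin 4)) at ho
    change C (Sum.inr (2 : Fin 4)) ◃ C (Sum.inr (0 : Fin 4)) = C (Sum.inr (3 : Fin 4)) at hu
    have h0 : C (Sum.inr (0 : Fin 4)) = x n := by rw [← h.ne, ← hCx]; exact hn.symm
    have h2 : C (Sum.inr (2 : Fin 4)) = x (n + d) := by rw [← h.se, ← hCx]; exact hs.symm
    refine ⟨x, hx, ?_⟩
    rintro (e | e)
    · exact hCx e
    · change Fin 4 at e
      fin_cases e
      · exact h0
      · exact ho.symm.trans h2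
      · exact h2
      · refine hu.symm.trans ?_
        rw [h0, h2, hx]
        change _ = x (n + 2 * d)
        congr 1
        ring

theorem add_negOne {T : TangleDiagram} {n d : ℤ} (h : T.HasLabelling n d) :
    (T.add negOne).HasLabelling (n - d) d := by
  obtain ⟨ℓ, h⟩ := h
  -- Here the over-strand carries `n` and reflects `n + d` to `n - d`.
  refine ⟨Sum.elim ℓ ![n, n - d, n + d, n], h.nw, rfl, h.sw, ?_,
    h.coloring.add ⟨?_, ?_, ?_⟩ h.ne h.se, fun X _ hX C hC => ?_⟩
  · change n = n - d + d
    ring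
  · intro c hc
    obtain rfl := List.mem_singleton.1 hc
    rfl
  · intro c hc
    obtain rfl := List.mem_singleton.1 hc
    change 2 * n - (n - d) = n + d
    ring
  · intro a b hab
    cases hab
  · obtain ⟨hS, hT, hn, hs⟩ := hC.of_add
    obtain ⟨x, hx, hCx⟩ := h.exists_seq X hX _ hS
    have ho := hT.over_eq _ (List.mem_singleton_self _)
    have hu := hT.under_eq _ (List.mem_singleton_self _)
    change C (Sum.inr (0 : Fin 4)) = C (Sum.inr (3 : Fin 4)) at ho
    change C (Sum.inr (0 : Fin 4)) ◃ C (Sum.inr (1 : Fin 4)) = C (Sum.inr (2 : Fin 4)) at hu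
    have h0 : C (Sum.inr (0 : Fin 4)) = x n := by rw [← h.ne, ← hCx]; exact hn.symm
    have h2 : C (Sum.inr (2 : Fin 4)) = x (n + d) := by rw [← h.se, ← hCx]; exact hs.symm
    have h1 : C (Sum.inr (1 : Fin 4)) = x (n - d) := by
      rw [← hX (C (Sum.inr (0 : Fin 4))) (C (Sum.inr (1 : Fin 4))), hu, h0, h2, hx]
      congr 1
      ring
    refine ⟨x, hx, ?_⟩
    rintro (e | e)
    · exact hCx e
    · change Fin 4 at e
      fin_cases e
      · exact h0
      · exact h1
      · exact h2
      · exact ho.symm.trans h0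

theorem twist (k : ℤ) : (TangleDiagram.twist k).HasLabelling k 1 := by
  have pos : ∀ n : ℕ, ((fun T => T.add one)^[n] TangleDiagram.zero).HasLabelling n 1 := by
    intro n
    induction n with
    | zero => exact zero
    | succ n ih =>
      rw [Function.iterate_succ_apply']
      exact_mod_cast ih.add_one
  have neg : ∀ n : ℕ,
      ((fun T => T.add negOne)^[n] TangleDiagram.zero).HasLabelling (-(n : ℤ)) 1 := by
    intro n
    induction n with
    | zero => exact zero
    | succ n ih =>
      rw [Function.iterate_succ_apply']
      convert ih.add_negOne using 1
      push_cast
      ring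
  cases k with
  | ofNat n => exact pos n
  | negSucc n =>
    rw [Int.negSucc_eq]
    exact_mod_cast neg (n + 1)

end HasLabelling

end TangleDiagram

namespace RationalTangle

theorem hasLabelling_frac (t : RationalTangle) :
    t.diagram.HasLabelling t.frac.1 t.frac.2 := by
  induction t with
  | zero => exact .zero
  | addOne t ih => exact ih.add_one
  | subOne t ih => exact ih.add_negOne
  | rot t ih => exact ih.rot

/-- Coprime pairs with the same ratio divide each other entrywise, so they agree up to signs;
opposite signs are possible only if an entry vanishes. -/
theorem HasFraction.hasLabelling {t : RationalTangle} {p q : ℤ} (h : t.HasFraction p q)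
    (hpq : IsCoprime p q) : t.diagram.HasLabelling p q := by
  have hc := t.isCoprime_frac
  have hl := t.hasLabelling_frac
  generalize t.diagram = T at hl ⊢
  unfold HasFraction at h
  generalize t.frac.1 = n at *
  generalize t.frac.2 = d at *
  have h₁ : n ∣ p := hc.dvd_of_dvd_mul_right ⟨q, h.symm⟩
  have h₂ : d ∣ q := hc.symm.dvd_of_dvd_mul_left ⟨p, by linarith⟩
  have h₃ : p ∣ n := hpq.dvd_of_dvd_mul_right ⟨d, h⟩
  have h₄ : q ∣ d := hpq.symm.dvd_of_dvd_mul_left ⟨n, by linarith⟩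
  rcases Int.natAbs_eq_natAbs_iff.1 (Nat.dvd_antisymm (Int.natAbs_dvd_natAbs.2 h₁)
    (Int.natAbs_dvd_natAbs.2 h₃)) with rfl | rfl <;>
  rcases Int.natAbs_eq_natAbs_iff.1 (Nat.dvd_antisymm (Int.natAbs_dvd_natAbs.2 h₂)
    (Int.natAbs_dvd_natAbs.2 h₄)) with rfl | rfl
  · exact hl
  · have : n * q = 0 := by linarith
    rcases mul_eq_zero.1 this with rfl | rfl
    · simpa using hl.neg
    · simpa using hl
  · have : p * d = 0 := by linarith
    rcases mul_eq_zero.1 this with rfl | rfl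
    · simpa using hl
    · simpa using hl.neg
  · simpa using hl.neg

end RationalTangle

/-! ### Presented involutory quandles -/

/-- The value of a formal product in a quandle. -/
def FreeMagma.evalAct {E X : Type} [Quandle X] (C : E → X) : FreeMagma E → X
  | .of e => C e
  | .mul x y => evalAct C y ◃ evalAct C x

namespace PresentedInvQuandle

variable {E : Type} {r : FreeMagma E → FreeMagma E → Prop}

/-- The class of a generator. -/
def gen (r : FreeMagma E → FreeMagma E → Prop) (e : E) : PresentedInvQuandle r :=
  Quotient.mk (invQuandleSetoid r) (.of e)

theorem induction_on {P : PresentedInvQuandle r → Prop} (hgen : ∀ e, P (gen r e))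
    (hact : ∀ x y, P x → P y → P (x ◃ y)) (x : PresentedInvQuandle r) : P x := by
  refine Quotient.inductionOn x fun m => ?_
  induction m with
  | ih1 e => exact hgen e
  | ih2 m n ihm ihn => exact hact _ _ ihn ihm

theorem exists_hom {X : Type} [Quandle X] (hX : Rack.IsInvolutory X) (C : E → X)
    (hC : ∀ x y, r x y → FreeMagma.evalAct C x = FreeMagma.evalAct C y) :
    ∃ f : PresentedInvQuandle r → X, (∀ x y, f (x ◃ y) = f x ◃ f y) ∧ ∀ e, f (gen r e) = C e := by
  have sound : ∀ x y, InvQuandleRel r x y → FreeMagma.evalAct C x = FreeMagma.evalAct C y := by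
    intro x y h
    induction h with
    | of h => exact hC _ _ h
    | refl => rfl
    | symm _ ih => exact ih.symm
    | trans _ _ ih₁ ih₂ => exact ih₁.trans ih₂
    | mul _ _ ih₁ ih₂ => exact congrArg₂ (fun a b => b ◃ a) ih₁ ih₂
    | idem x => exact Quandle.fix
    | invol x y => exact hX _ _
    | distrib x y z => exact Shelf.self_distrib
  exact ⟨Quotient.lift (FreeMagma.evalAct C) sound,
    fun x y => Quotient.inductionOn₂ x y fun _ _ => rfl, fun _ => rfl⟩

end PresentedInvQuandle

namespace LinkDiagram

theorem isColoring_gen (D : LinkDiagram) :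
    IsColoring (X := D.InvolutoryQuandle) Shelf.act D.crossings D.joins
      (PresentedInvQuandle.gen D.QuandleRel) where
  over_eq c hc := Quotient.sound (.of (.over c hc))
  under_eq c hc := Quotient.sound (.of (.under c hc))
  join_eq a b hab := Quotient.sound (.of (.join a b hab))

theorem exists_hom_of_isColoring (D : LinkDiagram) {X : Type} [Quandle X]
    (hX : Rack.IsInvolutory X) {C : D.Edge → X}
    (hC : IsColoring Shelf.act D.crossings D.joins C) :
    ∃ f : D.InvolutoryQuandle → X, (∀ x y, f (x ◃ y) = f x ◃ f y) ∧
      ∀ e, f (PresentedInvQuandle.gen _ e) = C e := by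
  refine PresentedInvQuandle.exists_hom hX C fun x y h => ?_
  rcases h with ⟨c, hc⟩ | ⟨c, hc⟩ | ⟨a, b, hab⟩
  · exact hC.over_eq c hc
  · exact hC.under_eq c hc
  · exact hC.join_eq a b hab

end LinkDiagram

/-! ### The quandle of a Montesinos link with two tangles of fraction `1 / 2` -/

/-- Composing the reflections in `0` and in `p` or `q` gives translations by `2 * p` and `2 * q`,
hence by `2`; and one of `p`, `q` is odd. It lets identities along a dihedral sequence be checked at
two or three terms. -/
theorem Int.mem_of_reflection_closed {I : Set ℤ} {p q : ℤ} (hpq : IsCoprime p q) (h0 : 0 ∈ I)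
    (hp : p ∈ I) (hq : q ∈ I) (hI : ∀ i ∈ I, ∀ j ∈ I, 2 * j - i ∈ I) (i : ℤ) : i ∈ I := by
  have shift : ∀ s ∈ I, ∀ i ∈ I, ∀ m : ℤ, i + m * (2 * s) ∈ I := by
    intro s hs i hi m
    induction m with
    | zero => simpa using hi
    | succ n ih =>
      convert hI _ (hI _ ih 0 h0) s hs using 1
      ring
    | pred n ih =>
      convert hI _ (hI _ ih s hs) 0 h0 using 1
      ring
  obtain ⟨u, v, huv⟩ := hpq
  have even_shift : ∀ i ∈ I, ∀ k : ℤ, i + 2 * k ∈ I := by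
    intro i hi k
    convert shift q hq _ (shift p hp i hi (k * u)) (k * v) using 1
    linear_combination (-2 * k) * huv
  have even : ∀ k : ℤ, 2 * k ∈ I := fun k => by simpa using even_shift 0 h0 k
  obtain ⟨k, rfl | rfl⟩ := Int.even_or_odd' i
  · exact even k
  · obtain ⟨m, rfl | rfl⟩ := Int.even_or_odd' p
    · obtain ⟨n, rfl | rfl⟩ := Int.even_or_odd' q
      · have : 2 * (u * m + v * n) = 1 := by linarith
        omega
      · convert even_shift _ hq (k - n) using 1
        ring
    · convert even_shift _ hp (k - m) using 1
      ring

/-- An element and a dihedral sequence that satisfy the relations of the involutory quandle of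
the Montesinos link. -/
structure IsMontesinosSystem {X : Type} [Quandle X] (q w : ℤ) (α : X) (z : ℤ → X) : Prop where
  dihedral : IsDihedralSeq z
  act_zero : α ◃ z 0 = z (-q)
  act_neg : α ◃ z (-w) = z (-w - q)
  act_base : z 0 ◃ α = z (-w) ◃ α

/-- The other sequences can be eliminated: the twists continue `z` in steps of `q`, and each tangle
`1 / 2` is spanned by `α` and one term of `z`. The remaining gluing conditions become the three
relations. The conclusion records that `α` and `z` generate and are universal. -/
theorem exists_isMontesinosSystem {p q e w : ℤ} (hpq : IsCoprime p q) (hw : w = (e - 1) * q - p)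
    {t₁ t₂ t₃ : RationalTangle} (h₁ : t₁.diagram.HasLabelling 1 2)
    (h₂ : t₂.diagram.HasLabelling 1 2) (h₃ : t₃.diagram.HasLabelling p q) :
    ∃ (α : (montesinosDiagram t₁ t₂ t₃ e).InvolutoryQuandle)
      (z : ℤ → (montesinosDiagram t₁ t₂ t₃ e).InvolutoryQuandle),
      IsMontesinosSystem q w α z ∧
      (∀ P : (montesinosDiagram t₁ t₂ t₃ e).InvolutoryQuandle → Prop, P α → (∀ i, P (z i)) →
        (∀ x y, P x → P y → P (x ◃ y)) → ∀ x, P x) ∧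
      ∀ (X : Type) [Quandle X], Rack.IsInvolutory X → ∀ (α' : X) (z' : ℤ → X),
        IsMontesinosSystem q w α' z' →
        ∃ f : (montesinosDiagram t₁ t₂ t₃ e).InvolutoryQuandle → X,
          (∀ x y, f (x ◃ y) = f x ◃ f y) ∧ f α = α' ∧ ∀ i, f (z i) = z' i := by
  obtain ⟨ℓ₁, h₁⟩ := h₁
  obtain ⟨ℓ₂, h₂⟩ := h₂
  obtain ⟨ℓ₃, h₃⟩ := h₃
  obtain ⟨ℓ₄, h₄⟩ := TangleDiagram.HasLabelling.twist (-e)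
  set D := montesinosDiagram t₁ t₂ t₃ e
  have hQ : Rack.IsInvolutory D.InvolutoryQuandle := PresentedInvQuandle.isInvolutory _
  have hC := D.isColoring_gen
  have hC' : IsColoring Shelf.act
      ((((t₁.diagram.add t₂.diagram).add t₃.diagram).add (TangleDiagram.twist (-e))).crossings)
      ((((t₁.diagram.add t₂.diagram).add t₃.diagram).add (TangleDiagram.twist (-e))).joins)
      (PresentedInvQuandle.gen D.QuandleRel) :=
    ⟨hC.over_eq, hC.under_eq, fun a b hab => hC.join_eq a b (List.mem_append_left _ hab)⟩
  have hup := hC.join_eq _ _ (List.mem_append_right _ List.mem_cons_self)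
  have hlow := hC.join_eq _ _ (List.mem_append_right _ (List.mem_cons_of_mem _ List.mem_cons_self))
  obtain ⟨hC₃, c₄, n₃, s₃⟩ := hC'.of_add
  obtain ⟨hC₂, c₃, n₂, s₂⟩ := hC₃.of_add
  obtain ⟨c₁, c₂, n₁, s₁⟩ := hC₂.of_add
  obtain ⟨x, hx, hCx⟩ := h₁.exists_seq _ hQ _ c₁
  obtain ⟨y, hy, hCy⟩ := h₂.exists_seq _ hQ _ c₂
  obtain ⟨z, hz, hCz⟩ := h₃.exists_seq _ hQ _ c₃
  obtain ⟨u, hu, hCu⟩ := h₄.exists_seq _ hQ _ c₄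
  replace n₁ : x 1 = y 0 := by rw [← h₁.ne, ← h₂.nw, ← hCx, ← hCy]; exact n₁
  replace s₁ : x 3 = y 2 := by
    rw [show (3 : ℤ) = 1 + 2 by rfl, ← h₁.se, ← h₂.sw, ← hCx, ← hCy]; exact s₁
  replace n₂ : y 1 = z 0 := by rw [← h₂.ne, ← h₃.nw, ← hCy, ← hCz]; exact n₂
  replace s₂ : y 3 = z q := by
    rw [show (3 : ℤ) = 1 + 2 by rfl, ← h₂.se, ← h₃.sw, ← hCy, ← hCz]; exact s₂
  replace n₃ : z p = u 0 := by rw [← h₃.ne, ← h₄.nw, ← hCz, ← hCu]; exact n₃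
  replace s₃ : z (p + q) = u 1 := by rw [← h₃.se, ← h₄.sw, ← hCz, ← hCu]; exact s₃
  replace hup : x 0 = u (-e) := by rw [← h₁.nw, ← h₄.ne, ← hCx, ← hCu]; exact hup
  replace hlow : x 2 = u (-e + 1) := by rw [← h₁.sw, ← h₄.se, ← hCx, ← hCu]; exact hlow
  -- Both sides are dihedral sequences in `k`, and they agree at `0` and `1`.
  have hzu : ∀ k, z (p + k * q) = u k := by
    intro k
    refine Int.mem_of_reflection_closed (I := {k | z (p + k * q) = u k}) (p := 1) (q := 1)
      isCoprime_one_left ?_ ?_ ?_ ?_ k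
    · simpa using n₃
    · simpa using s₃
    · simpa using s₃
    · intro i hi j hj
      simp only [Set.mem_ofPred_eq] at hi hj ⊢
      rw [← hu, ← hi, ← hj, hz]
      congr 1
      ring
  have hx0 : x 0 = z (-w - q) := by
    rw [hup, ← hzu]
    congr 1
    rw [hw]
    ring
  have hx2 : x 2 = z (-w) := by
    rw [hlow, ← hzu]
    congr 1
    rw [hw]
    ring
  have hx1x2 : x 1 ◃ x 2 = x 0 := hx 2 1
  have hx2x1 : x 2 ◃ x 1 = x 3 := hx 1 2
  have hy1y0 : y 1 ◃ y 0 = y 2 := hy 0 1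
  have hy2y1 : y 2 ◃ y 1 = y 3 := hy 1 2
  refine ⟨x 1, z, ⟨hz, ?_, ?_, ?_⟩, ?_, ?_⟩
  · have h : z 0 ◃ (x 1 ◃ z 0) = z 0 ◃ z (-q) := by
      have h0 : z 0 ◃ z 0 = z 0 := Quandle.fix
      rw [hz, show 2 * 0 - -q = q by ring, ← s₂, ← hy2y1, ← hy1y0, ← n₁, n₂]
      exact Shelf.self_distrib.trans (by rw [h0])
    exact (Rack.left_cancel _).1 h
  · rw [← hx2, ← hx0, hx1x2]
  · rw [← hx2, hx2x1, ← n₂, n₁, hy1y0, s₁]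
  · intro P hα hPz hact v
    have hPx : ∀ i, P (x i) := Int.mem_of_reflection_closed (I := {i | P (x i)}) (p := 1) (q := 1)
      isCoprime_one_left (by simpa [hx0] using hPz _) hα hα fun i hi j hj => by
        have := hact _ _ hj hi
        rwa [hx] at this
    have hPy : ∀ i, P (y i) := Int.mem_of_reflection_closed (I := {i | P (y i)}) (p := 1) (q := 1)
      isCoprime_one_left (by simpa [← n₁] using hα) (by simpa [n₂] using hPz _)
      (by simpa [n₂] using hPz _) fun i hi j hj => by
        have := hact _ _ hj hi
        rwa [hy] at this
    refine PresentedInvQuandle.induction_on ?_ hact v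
    rintro (((a | a) | a) | a)
    · exact (hCx a).symm ▸ hPx _
    · exact (hCy a).symm ▸ hPy _
    · exact (hCz a).symm ▸ hPz _
    · exact (hCu a).symm ▸ hzu _ ▸ hPz _
  · intro X _ hX α' z' h'
    -- The sequences of the two tangles `1 / 2` are rebuilt from consecutive terms; `act_neg`,
    -- `act_base` and `act_zero` then supply the gluings at `x' 2`, `x' 3 = y' 2` and `y' 3`.
    obtain ⟨x', hx', hx'0, hx'1⟩ := exists_isDihedralSeq hX (z' (-w - q)) α'
    obtain ⟨y', hy', hy'0, hy'1⟩ := exists_isDihedralSeq hX α' (z' 0)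
    have hx'2 : x' 2 = z' (-w) := by
      have := hx' 0 1
      rw [hx'1, hx'0, ← h'.act_neg, hX] at this
      exact this.symm
    have hxy : x' 3 = y' 2 := by
      have h1 := hx' 1 2
      have h2 := hy' 0 1
      rw [hx'1, hx'2, ← h'.act_base] at h1
      rw [hy'0, hy'1] at h2
      exact h1.symm.trans h2
    have hy'3 : y' 3 = z' q := by
      have h1 := hy' 1 2
      have h2 := hy' 0 1
      rw [hy'0, hy'1] at h2
      have h3 : z' 0 ◃ (α' ◃ z' 0) = z' q := by
        rw [h'.act_zero, h'.dihedral]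
        congr 1
        ring
      have h0 : z' 0 ◃ z' 0 = z' 0 := Quandle.fix
      rw [Shelf.self_distrib, h0] at h3
      rw [hy'1] at h1
      change y' 2 ◃ z' 0 = y' 3 at h1
      change z' 0 ◃ α' = y' 2 at h2
      rw [← h1, ← h2, h3]
    have hz'u := h'.dihedral.comp_affine q p
    have k₁ := h₁.coloring.map x' (act' := Shelf.act) fun a b => hx' b a
    have k₂ := h₂.coloring.map y' (act' := Shelf.act) fun a b => hy' b a
    have k₃ := h₃.coloring.map z' (act' := Shelf.act) fun a b => h'.dihedral b a
    have k₄ := h₄.coloring.map (fun i => z' (q * i + p)) (act' := Shelf.act) fun a b => hz'u b a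
    have k₁₂ := k₁.add k₂ (by rw [h₁.ne, h₂.nw, hx'1, hy'0]) (by rw [h₁.se, h₂.sw]; exact hxy)
    have k₁₂₃ := k₁₂.add k₃ (by change y' _ = z' _; rw [h₂.ne, h₃.nw, hy'1])
      (by change y' _ = z' _; rw [h₂.se, h₃.sw]; exact hy'3)
    have k := k₁₂₃.add k₄ (by change z' _ = z' _; rw [h₃.ne, h₄.nw]; congr 1; ring)
      (by change z' _ = z' _; rw [h₃.se, h₄.sw]; congr 1; ring)
    obtain ⟨f, hf, hfC⟩ := D.exists_hom_of_isColoring hX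
      (C := Sum.elim (Sum.elim (Sum.elim (fun e => x' (ℓ₁ e)) fun e => y' (ℓ₂ e))
        fun e => z' (ℓ₃ e)) fun e => z' (q * ℓ₄ e + p)) ⟨k.over_eq, k.under_eq, fun a b hab => by
        rcases List.mem_append.1 hab with hab | hab
        · exact k.join_eq a b hab
        rcases List.mem_cons.1 hab with heq | hab
        · obtain ⟨rfl, rfl⟩ := Prod.mk.inj heq
          change x' _ = z' _
          rw [h₁.nw, h₄.ne, hx'0]
          congr 1
          rw [hw]
          ring
        · obtain ⟨rfl, rfl⟩ := Prod.mk.inj (List.mem_singleton.1 hab)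
          change x' _ = z' _
          rw [h₁.sw, h₄.se, hx'2]
          congr 1
          rw [hw]
          ring⟩
    refine ⟨f, hf, ?_, ?_⟩
    · rw [← h₁.ne, ← hCx]
      refine (hfC _).trans ?_
      change x' _ = _
      rw [h₁.ne, hx'1]
    · have hedge : ∀ a, f (z (ℓ₃ a)) = z' (ℓ₃ a) := fun a => by
        rw [← hCz]
        exact hfC _
      refine Int.mem_of_reflection_closed (I := {i | f (z i) = z' i}) hpq ?_ ?_ ?_ ?_
      · simpa [h₃.nw] using hedge t₃.diagram.nw
      · simpa [h₃.ne] using hedge t₃.diagram.ne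
      · simpa [h₃.sw] using hedge t₃.diagram.sw
      · intro i hi j hj
        simp only [Set.mem_ofPred_eq] at hi hj ⊢
        rw [← hz, hf, hi, hj, h'.dihedral]

/-! ### A model of the quandle -/

/-- The underlying set of the model: two dihedral quandles. -/
def MontesinosModel (q W : ℕ) (_c : ℤ) : Type := ZMod (2 * q * W) ⊕ ZMod (2 * W)

namespace MontesinosModel

variable {q W : ℕ} {c : ℤ}

instance [NeZero q] [NeZero W] : Finite (MontesinosModel q W c) :=
  inferInstanceAs (Finite (ZMod (2 * q * W) ⊕ ZMod (2 * W)))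

/-- The elements of the large dihedral quandle. -/
def z (i : ℤ) : MontesinosModel q W c := Sum.inl i

/-- The elements of the small dihedral quandle. -/
def a (k : ℤ) : MontesinosModel q W c := Sum.inr k

theorem z_eq_z {i j : ℤ} : (z i : MontesinosModel q W c) = z j ↔ ((2 * q * W : ℕ) : ℤ) ∣ j - i := by
  rw [← ZMod.intCast_eq_intCast_iff_dvd_sub]
  exact Sum.inl_injective.eq_iff

theorem a_eq_a {i j : ℤ} : (a i : MontesinosModel q W c) = a j ↔ ((2 * W : ℕ) : ℤ) ∣ j - i := by
  rw [← ZMod.intCast_eq_intCast_iff_dvd_sub]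
  exact Sum.inr_injective.eq_iff

theorem z_ne_a {i k : ℤ} : (z i : MontesinosModel q W c) ≠ a k := Sum.inl_ne_inr

@[elab_as_elim]
theorem rec_int {P : MontesinosModel q W c → Prop} (hz : ∀ i, P (z i)) (ha : ∀ k, P (a k)) (x) :
    P x := by
  rcases x with x | x <;> obtain ⟨i, rfl⟩ := ZMod.intCast_surjective x
  · exact hz i
  · exact ha i

/-- Multiplication by `q` as a map from residues modulo `2W` to residues modulo `2qW`. -/
def scale (q W : ℕ) : ZMod (2 * W) →+ ZMod (2 * q * W) :=
  ZMod.lift (2 * W) ⟨(AddMonoidHom.mulLeft (q : ZMod (2 * q * W))).comp (Int.castAddHom _), by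
    change (q : ZMod (2 * q * W)) * ((2 * W : ℕ) : ℤ) = 0
    rw [Int.cast_natCast, ← Nat.cast_mul, ZMod.natCast_eq_zero_iff]
    exact ⟨1, by ring⟩⟩

theorem scale_intCast (i : ℤ) : scale q W i = ((q * i : ℤ) : ZMod (2 * q * W)) := by
  rw [scale, ZMod.lift_coe]
  simp

/-- Reduction modulo `2W`. -/
def reduce (q W : ℕ) : ZMod (2 * q * W) →+* ZMod (2 * W) :=
  ZMod.castHom ⟨q, by ring⟩ _

/-- The operation of the model. -/
def act : MontesinosModel q W c → MontesinosModel q W c → MontesinosModel q W c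
  | Sum.inl j, Sum.inl i => Sum.inl (2 * j - i)
  -- For `k = 0` this is `z i ↦ z (-q + i * (1 - 2 * c * q))`, the formula that the relations force
  -- on `α = a 0`. The bracket matters only modulo `2 * W`, as it is multiplied by `q`.
  | Sum.inr k, Sum.inl i => Sum.inl (i - scale q W (1 + 2 * k + 2 * c * reduce q W i))
  | Sum.inr k, Sum.inr j => Sum.inr (2 * k - j)
  | Sum.inl i, Sum.inr j => Sum.inr (-1 - j - 2 * c * reduce q W i)

theorem act_z_z (i j : ℤ) : act (z j) (z i) = (z (2 * j - i) : MontesinosModel q W c) := by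
  simp [act, z]
  rfl

theorem act_a_z (k i : ℤ) :
    act (a k) (z i) = (z (i - q * (1 + 2 * k + 2 * c * i)) : MontesinosModel q W c) := by
  have : (1 + 2 * (k : ZMod (2 * W)) + 2 * c * reduce q W i) =
    ((1 + 2 * k + 2 * c * i : ℤ) : ZMod (2 * W)) := by simp
  simp only [act, z, a, this, scale_intCast]
  push_cast
  rfl

theorem act_a_a (j k : ℤ) : act (a k) (a j) = (a (2 * k - j) : MontesinosModel q W c) := by
  simp [act, a]
  rfl

theorem act_z_a (i j : ℤ) :
    act (z i) (a j) = (a (-1 - j - 2 * c * i) : MontesinosModel q W c) := by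
  simp [act, z, a]
  rfl

variable [hc : Fact ((W : ℤ) ∣ c * q - 1)]

/-- The multiplier `1 - 2 * c * q` squares to `1` modulo `2 * q * W` because `c` inverts `q` modulo
`W`. Only the action of `a k` on `z i` needs this. -/
theorem act_act (x y : MontesinosModel q W c) : act x (act x y) = y := by
  obtain ⟨m, hm⟩ := hc.out
  refine rec_int (fun j => ?_) (fun k => ?_) x <;> refine rec_int (fun i => ?_) (fun i => ?_) y
  · rw [act_z_z, act_z_z, z_eq_z]
    exact ⟨0, by ring⟩
  · rw [act_z_a, act_z_a, a_eq_a]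
    exact ⟨0, by ring⟩
  · rw [act_a_z, act_a_z, z_eq_z]
    refine ⟨-m * (1 + 2 * k + 2 * c * i), ?_⟩
    push_cast
    linear_combination (-2 * q * (1 + 2 * k + 2 * c * i) : ℤ) * hm
  · rw [act_a_a, act_a_a, a_eq_a]
    exact ⟨0, by ring⟩

theorem act_distrib (x y v : MontesinosModel q W c) :
    act x (act y v) = act (act x y) (act x v) := by
  obtain ⟨m, hm⟩ := hc.out
  refine rec_int (fun i => ?_) (fun i => ?_) x <;> refine rec_int (fun j => ?_) (fun j => ?_) y <;>
    refine rec_int (fun k => ?_) (fun k => ?_) v <;>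
    simp only [act_z_z, act_a_z, act_a_a, act_z_a, z_eq_z, a_eq_a]
  · exact ⟨0, by ring⟩
  · exact ⟨0, by ring⟩
  · exact ⟨0, by ring⟩
  · exact ⟨0, by ring⟩
  · exact ⟨0, by ring⟩
  -- This case (a, z, a) and the next one (a, a, z) use that `c` inverts `q` modulo `W`; the other
  -- six are identities of integers.
  · refine ⟨m * (1 + 2 * i + 2 * c * j), ?_⟩
    push_cast
    linear_combination (2 * (1 + 2 * i + 2 * c * j) : ℤ) * hm
  · refine ⟨m * (2 * (i - j)), ?_⟩
    push_cast
    linear_combination (4 * q * (i - j) : ℤ) * hm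
  · exact ⟨0, by ring⟩

instance : Quandle (MontesinosModel q W c) where
  act := act
  invAct := act
  self_distrib := act_distrib _ _ _
  left_inv x y := act_act x y
  right_inv x y := act_act x y
  fix {x} := by
    refine rec_int (fun i => ?_) (fun i => ?_) x
    · rw [act_z_z, two_mul, add_sub_cancel_right]
    · rw [act_a_a, two_mul, add_sub_cancel_right]

theorem isInvolutory : Rack.IsInvolutory (MontesinosModel q W c) := act_act

theorem isMontesinosSystem {w : ℤ} (hw : (W : ℤ) ∣ w) :
    IsMontesinosSystem q w (a 0 : MontesinosModel q W c) z where
  dihedral := act_z_z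
  act_zero := (act_a_z _ _).trans (by simp)
  act_neg := (act_a_z _ _).trans (by
    obtain ⟨v, rfl⟩ := hw
    rw [z_eq_z]
    refine ⟨-c * v, ?_⟩
    push_cast
    ring)
  act_base := (act_z_a _ _).trans <| Eq.trans (by
    obtain ⟨v, rfl⟩ := hw
    rw [a_eq_a]
    refine ⟨c * v, ?_⟩
    push_cast
    ring) (act_z_a _ _).symm

end MontesinosModel

/-! ### Consequences of the relations -/

namespace IsDihedralSeq

variable {X : Type} [Quandle X] {z : ℤ → X}

/-- The translation of a dihedral sequence by two steps. -/
def translation (z : ℤ → X) : Equiv.Perm X := Rack.act' (z 0) * Rack.act' (z 1)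

/-- Since `z (i + 1) = z i ◃ z (i - 1)`, the product of the actions of two consecutive terms does
not depend on where they stand. -/
theorem act'_eq (hX : Rack.IsInvolutory X) (hz : IsDihedralSeq z) (i : ℤ) :
    Rack.act' (z i) = Rack.act' (z 0) * translation z ^ i := by
  have hsq := fun i => Rack.act'_mul_self hX (z i)
  have hconst : ∀ i, Rack.act' (z (i + 1)) = Rack.act' (z i) * translation z := by
    have step : ∀ i, Rack.act' (z i) * Rack.act' (z (i + 1)) =
        Rack.act' (z (i - 1)) * Rack.act' (z (i - 1 + 1)) := by
      intro i
      have h : z (i + 1) = z i ◃ z (i - 1) := by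
        rw [hz]
        congr 1
        ring
      rw [h, Rack.act'_act hX, sub_add_cancel, ← mul_assoc, ← mul_assoc, hsq, one_mul]
    have all : ∀ i, Rack.act' (z i) * Rack.act' (z (i + 1)) = translation z := by
      intro i
      induction i with
      | zero => rfl
      | succ n ih => rw [step, add_sub_cancel_right, ih]
      | pred n ih => rw [← step, ih]
    intro i
    rw [← all i, ← mul_assoc, hsq, one_mul]
  induction i with
  | zero => simp
  | succ n ih => rw [hconst, ih, mul_assoc, ← zpow_add_one]
  | pred n ih =>
    have h := hconst (-n - 1)
    rw [sub_add_cancel, ih] at h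
    rw [zpow_sub_one, ← mul_assoc, h, mul_inv_cancel_right]

theorem translation_zpow (hX : Rack.IsInvolutory X) (hz : IsDihedralSeq z) (k : ℤ) :
    translation z ^ k = Rack.act' (z 0) * Rack.act' (z k) := by
  rw [hz.act'_eq hX k, ← mul_assoc, Rack.act'_mul_self hX, one_mul]

theorem translation_zpow_apply (hX : Rack.IsInvolutory X) (hz : IsDihedralSeq z) (k i : ℤ) :
    (translation z ^ k) (z i) = z (i - 2 * k) := by
  rw [hz.translation_zpow hX, Equiv.Perm.mul_apply, Rack.act'_apply, Rack.act'_apply, hz, hz]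
  congr 1
  ring

theorem act'_mul_translation_zpow (hX : Rack.IsInvolutory X) (z : ℤ → X) (k : ℤ) :
    Rack.act' (z 0) * translation z ^ k = translation z ^ (-k) * Rack.act' (z 0) := by
  refine conj_zpow_of_conj_eq_inv (Rack.act'_mul_self hX _) ?_ k
  rw [translation, mul_inv_rev, Rack.act'_inv hX, Rack.act'_inv hX, ← mul_assoc,
    Rack.act'_mul_self hX, one_mul]

end IsDihedralSeq

/-! ### The action of `α` on translations, and the size of the quandle -/

namespace IsMontesinosSystem

open IsDihedralSeq

variable {X : Type} [Quandle X] {q w : ℤ} {α : X} {z : ℤ → X}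

/-- Conjugation by `α` moves the reflections in `z 0` and `z (-w)` to those in `z (-q)` and `z (-w -
q)`, which are equally far apart. -/
theorem conj_translation_neg_w (hX : Rack.IsInvolutory X) (h : IsMontesinosSystem q w α z) :
    Rack.act' α * translation z ^ (-w) * Rack.act' α = translation z ^ (-w) := by
  have hσ := Rack.act'_mul_self hX α
  have e₁ := Rack.act'_act hX α (z 0)
  have e₂ := Rack.act'_act hX α (z (-w))
  rw [h.act_zero] at e₁
  rw [h.act_neg] at e₂
  calc _ = (Rack.act' α * Rack.act' (z 0) * Rack.act' α) *
        (Rack.act' α * Rack.act' (z (-w)) * Rack.act' α) := by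
        rw [h.dihedral.translation_zpow hX]
        simp only [mul_assoc]
        rw [← mul_assoc (Rack.act' α) (Rack.act' α), hσ, one_mul]
    _ = Rack.act' (z (-q)) * Rack.act' (z (-w - q)) := by rw [e₁, e₂]
    _ = _ := by
      rw [h.dihedral.act'_eq hX (-q), h.dihedral.act'_eq hX (-w - q),
        act'_mul_translation_zpow hX, mul_assoc, ← mul_assoc (Rack.act' (z 0)),
        Rack.act'_mul_self hX, one_mul, ← zpow_add]
      congr 1
      ring

/-- Here `α` exchanges `z 0` and `z (-q)`, which reverses the translation between them. -/
theorem conj_translation_neg_q (hX : Rack.IsInvolutory X) (h : IsMontesinosSystem q w α z) :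
    Rack.act' α * translation z ^ (-q) * Rack.act' α = translation z ^ q := by
  have hσ := Rack.act'_mul_self hX α
  have e₁ := Rack.act'_act hX α (z 0)
  rw [h.act_zero] at e₁
  have e₂ : Rack.act' (z 0) = Rack.act' α * Rack.act' (z (-q)) * Rack.act' α := by
    rw [e₁]
    simp only [mul_assoc]
    rw [hσ, mul_one, ← mul_assoc, hσ, one_mul]
  calc _ = (Rack.act' α * Rack.act' (z 0) * Rack.act' α) *
        (Rack.act' α * Rack.act' (z (-q)) * Rack.act' α) := by
        rw [h.dihedral.translation_zpow hX]
        simp only [mul_assoc]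
        rw [← mul_assoc (Rack.act' α) (Rack.act' α), hσ, one_mul]
    _ = Rack.act' (z (-q)) * Rack.act' (z 0) := by rw [← e₁, ← e₂]
    _ = _ := by
      rw [h.dihedral.act'_eq hX (-q), act'_mul_translation_zpow hX, mul_assoc,
        Rack.act'_mul_self hX, mul_one, neg_neg]

variable {a c : ℤ}

theorem conj_translation_zpow (hX : Rack.IsInvolutory X) (h : IsMontesinosSystem q w α z)
    (hac : c * q - a * w = 1) (k : ℤ) :
    Rack.act' α * translation z ^ k = translation z ^ (k * (1 - 2 * (c * q))) * Rack.act' α := by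
  have hσ := Rack.act'_mul_self hX α
  have hi := Rack.act'_inv hX α
  have e₁ := h.conj_translation_neg_w hX
  have e₂ := h.conj_translation_neg_q hX
  have key : Rack.act' α * translation z ^ k * (Rack.act' α)⁻¹ =
      translation z ^ (k * (1 - 2 * (c * q))) := by
    have hk : translation z ^ k =
        (translation z ^ (-w)) ^ (a * k) * (translation z ^ (-q)) ^ (-(c * k)) := by
      rw [← zpow_mul, ← zpow_mul, ← zpow_add]
      congr 1
      linear_combination (-k) * hac
    rw [← hi] at e₁ e₂
    nth_rewrite 1 [hi] at e₁
    nth_rewrite 1 [hi] at e₂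
    rw [hk, ← conj_mul, ← conj_zpow (i := a * k), ← conj_zpow (i := -(c * k)), e₁, e₂, ← zpow_mul,
      ← zpow_mul, ← zpow_add]
    congr 1
    linear_combination k * hac
  rw [← key, inv_mul_cancel_right]

/-- `T ^ (q * w)` is fixed as a power of `T ^ w` and inverted as a power of `T ^ q`. -/
theorem translation_zpow_eq_one (hX : Rack.IsInvolutory X) (h : IsMontesinosSystem q w α z) :
    translation z ^ (2 * q * w) = 1 := by
  have hi := Rack.act'_inv hX α
  have e₁ := h.conj_translation_neg_w hX
  have e₂ := h.conj_translation_neg_q hX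
  rw [← hi] at e₁ e₂
  nth_rewrite 1 [hi] at e₁
  nth_rewrite 1 [hi] at e₂
  have f₁ := congrArg (· ^ q) e₁
  have f₂ := congrArg (· ^ w) e₂
  simp only [conj_zpow, ← zpow_mul] at f₁ f₂
  rw [mul_comm (-q) w, ← neg_mul_comm, f₁] at f₂
  rw [show 2 * q * w = q * w - (-w) * q by ring, zpow_sub, ← f₂, mul_inv_cancel]

theorem act_z_even (hX : Rack.IsInvolutory X) (h : IsMontesinosSystem q w α z)
    (hac : c * q - a * w = 1) (k : ℤ) :
    α ◃ z (2 * k) = z (-q + 2 * k * (1 - 2 * (c * q))) := by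
  have e := DFunLike.congr_fun (h.conj_translation_zpow hX hac (-k)) (z 0)
  simp only [Equiv.Perm.mul_apply, h.dihedral.translation_zpow_apply hX, Rack.act'_apply,
    h.act_zero] at e
  convert e using 2
  · congr 1
    ring
  · ring

theorem act_z_neg_w (hX : Rack.IsInvolutory X) (h : IsMontesinosSystem q w α z)
    (hac : c * q - a * w = 1) (k : ℤ) :
    α ◃ z (-w + 2 * k) = z (-w - q + 2 * k * (1 - 2 * (c * q))) := by
  have e := DFunLike.congr_fun (h.conj_translation_zpow hX hac (-k)) (z (-w))
  simp only [Equiv.Perm.mul_apply, h.dihedral.translation_zpow_apply hX, Rack.act'_apply,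
    h.act_neg] at e
  convert e using 2
  · congr 1
    ring
  · ring

theorem z_add_mul (hX : Rack.IsInvolutory X) (h : IsMontesinosSystem q w α z) (i m : ℤ) :
    z (i + 4 * q * w * m) = z i := by
  have := h.dihedral.translation_zpow_apply hX (2 * q * w * -m) i
  rw [zpow_mul, h.translation_zpow_eq_one hX, one_zpow, Equiv.Perm.one_apply] at this
  rw [this]
  congr 1
  ring

/-- `T ^ (2 * q * w) = 1` only gives the period `4 * q * w`. To halve it, an action of `α` is
evaluated in two ways, from the base points `0` and `-w` or by involutivity, so that the indices
differ by an odd multiple of `2 * q * w`. The evaluations that are available depend on the parities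
of `q` and `w`, which are not both even. -/
theorem z_add_period (hX : Rack.IsInvolutory X) (h : IsMontesinosSystem q w α z)
    (hac : c * q - a * w = 1) (i : ℤ) : z (i + 2 * q * w) = z i := by
  have hE := h.act_z_even hX hac
  have hO := h.act_z_neg_w hX hac
  have hshift : ∀ i k : ℤ, z (i + 2 * q * w) = z i → z (i + 2 * k + 2 * q * w) = z (i + 2 * k) := by
    intro i k hi
    have := congrArg (translation z ^ (-k)) hi
    rw [h.dihedral.translation_zpow_apply hX, h.dihedral.translation_zpow_apply hX] at this
    convert this using 2 <;> ring
  have hodd : ∀ i j m : ℤ, Odd m → j = i + 2 * q * w * m → z j = z i →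
      z (i + 2 * q * w) = z i := by
    rintro i j m ⟨n, rfl⟩ rfl hij
    rw [← hij, ← h.z_add_mul hX (i + 2 * q * w) n]
    congr 1
    ring
  have hσ : ∀ v, α ◃ (α ◃ v) = v := hX α
  have suff : z (0 + 2 * q * w) = z 0 → (∃ j, Odd j ∧ z (j + 2 * q * w) = z j) →
      z (i + 2 * q * w) = z i := by
    rintro h0 ⟨_, ⟨l, rfl⟩, hj⟩
    obtain ⟨k, rfl | rfl⟩ := Int.even_or_odd' i
    · simpa using hshift 0 k h0
    · convert hshift _ (k - l) hj using 2 <;> ring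
  rcases Int.even_or_odd w with hw | hw
  · obtain ⟨v, hv⟩ := hw
    have hcq : Odd (c * q) := ⟨a * v, by rw [hv] at hac; linarith⟩
    obtain ⟨hc, hq⟩ := Int.odd_mul.1 hcq
    -- The index `-w` is even, so `α ◃ z (-w)` is given both by `act_neg` and from the base point
    -- `0`; the answers differ by `2 * q * w * c`.
    have hj : z (-w - q + 2 * q * w) = z (-w - q) := by
      refine hodd _ (-q + 2 * -v * (1 - 2 * (c * q))) c hc ?_ ?_
      · rw [hv]
        ring
      · rw [← hE, ← h.act_neg, hv]
        congr 2
        ring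
    have hjodd : Odd (-w - q) := Even.sub_odd (by rw [hv]; exact ⟨-v, by ring⟩) hq
    refine suff ?_ ⟨_, hjodd, hj⟩
    refine (Rack.left_cancel α).1 ?_
    have e₁ := hE (q * w)
    have e₂ := hE 0
    rw [mul_zero, zero_mul, add_zero] at e₂
    rw [show 0 + 2 * q * w = 2 * (q * w) by ring, e₁, e₂]
    have e₃ := hshift _ v hj
    rw [show -w - q + 2 * v = -q by rw [hv]; ring] at e₃
    rw [← e₃, ← h.z_add_mul hX (-q + 2 * q * w) (-(c * q))]
    congr 1
    ring
  · rcases Int.even_or_odd q with hq | hq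
    · obtain ⟨s, hs⟩ := hq
      have haw : Odd (a * w) := ⟨c * s - 1, by rw [hs] at hac; linarith⟩
      have ha : Odd a := (Int.odd_mul.1 haw).1
      refine suff ?_ ⟨-w, hw.neg, ?_⟩
      -- Applying `α` twice to `z 0` returns `z 0`, but the formula at `-q` gives the index `2 * q *
      -- w * a`.
      · refine hodd 0 (-q + 2 * -s * (1 - 2 * (c * q))) a ha ?_ ?_
        · linear_combination (1 - 2 * (c * q)) * hs + 2 * q * hac
        · rw [← hE, show 2 * -s = -q by rw [hs]; ring, ← h.act_zero, hσ]
      · refine hodd (-w) (-w - q + 2 * -s * (1 - 2 * (c * q))) a ha ?_ ?_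
        · linear_combination (1 - 2 * (c * q)) * hs + 2 * q * hac
        · rw [← hO, show -w + 2 * -s = -w - q by rw [hs]; ring, ← h.act_neg, hσ]
    · have hca : Odd (a - c) := by
        obtain ⟨s, hs⟩ := hq
        obtain ⟨v, hv⟩ := hw
        refine ⟨c * s - a * v - 1, ?_⟩
        rw [hs, hv] at hac
        linarith
      have h0 : z (0 + 2 * q * w) = z 0 := by
        obtain ⟨s, hs⟩ := hw.sub_odd hq
        -- Now `-q` has the parity of `-w`; evaluating `α ◃ z (-q) = z 0` from there gives the index
        -- `2 * q * w * (a - c)`.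
        refine hodd 0 (-w - q + 2 * s * (1 - 2 * (c * q))) (a - c) hca ?_ ?_
        · linear_combination -(1 - 2 * (c * q)) * hs + 2 * q * hac
        · rw [← hO, show -w + 2 * s = -q by linarith, ← h.act_zero, hσ]
      refine suff h0 ⟨-q, hq.neg, ?_⟩
      refine hodd (-q) (-q + 2 * (q * w) * (1 - 2 * (c * q))) (1 - 2 * (c * q))
        ⟨-(c * q), by ring⟩ (by ring) ?_
      rw [← hE, ← h.act_zero, ← h0]
      congr 2
      ring

theorem z_eq_of_dvd (hX : Rack.IsInvolutory X) (h : IsMontesinosSystem q w α z)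
    (hac : c * q - a * w = 1) {i j : ℤ} (hij : 2 * q * w ∣ j - i) : z i = z j := by
  obtain ⟨m, hm⟩ := hij
  obtain rfl : j = i + 2 * q * w * m := by linarith
  induction m generalizing i with
  | zero => simp
  | succ n ih =>
    rw [mul_add, ← add_assoc, mul_one, h.z_add_period hX hac]
    exact ih (by ring)
  | pred n ih =>
    rw [← h.z_add_period hX hac (i + 2 * q * w * (-n - 1)), ih (by ring)]
    congr 1
    ring

/-- By `act_base`, `T ^ (-w)` fixes `α`, and `z i ◃ α` is `z 0 ◃ (T ^ i) α`. -/
theorem act_z_base_eq_of_dvd (hX : Rack.IsInvolutory X) (h : IsMontesinosSystem q w α z)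
    {i j : ℤ} (hij : w ∣ j - i) : z i ◃ α = z j ◃ α := by
  have fixed : (translation z ^ (-w)) α = α := by
    rw [h.dihedral.translation_zpow hX, Equiv.Perm.mul_apply, Rack.act'_apply, Rack.act'_apply,
      ← h.act_base, hX]
  obtain ⟨m, hm⟩ := hij
  have hfix : (translation z ^ (w * m)) α = α := by
    rw [show w * m = -w * -m by ring, zpow_mul]
    exact Equiv.Perm.zpow_apply_eq_self_of_apply_eq_self fixed _
  rw [← Rack.act'_apply, ← Rack.act'_apply, h.dihedral.act'_eq hX i, h.dihedral.act'_eq hX j,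
    show j = i + w * m by linarith, zpow_add, Equiv.Perm.mul_apply, Equiv.Perm.mul_apply,
    Equiv.Perm.mul_apply, hfix]

/-- The elements of the quandle generated by the system. -/
theorem exhaustion (hX : Rack.IsInvolutory X) (h : IsMontesinosSystem q w α z)
    (hac : c * q - a * w = 1)
    (hgen : ∀ P : X → Prop, P α → (∀ i, P (z i)) → (∀ x y, P x → P y → P (x ◃ y)) → ∀ x, P x)
    (v : X) : (∃ i, v = z i) ∨ (∃ k, v = z k ◃ α) ∨ ∃ k, v = z 0 ◃ (z k ◃ α) := by
  set P : X → Prop :=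
    fun v => (∃ i, v = z i) ∨ (∃ k, v = z k ◃ α) ∨ ∃ k, v = z 0 ◃ (z k ◃ α) with hP
  have hT := h.dihedral.translation_zpow hX
  have hTapp : ∀ (k : ℤ) u, (translation z ^ k) u = z 0 ◃ (z k ◃ u) := fun k u => by
    rw [hT]
    rfl
  have hz : ∀ (k : ℤ) u, z k ◃ u = z 0 ◃ (translation z ^ k) u := fun k u => by
    rw [hTapp, hX]
  have hα : α ◃ α = α := Quandle.fix
  have hζT : ∀ (k : ℤ) u, z 0 ◃ (translation z ^ k) u = (translation z ^ (-k)) (z 0 ◃ u) :=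
    fun k u => DFunLike.congr_fun (act'_mul_translation_zpow hX z k) u
  have hσT : ∀ (k : ℤ) u,
      α ◃ (translation z ^ k) u = (translation z ^ (k * (1 - 2 * (c * q)))) (α ◃ u) :=
    fun k u => DFunLike.congr_fun (h.conj_translation_zpow hX hac k) u
  have hTT : ∀ (k l : ℤ) u, (translation z ^ k) ((translation z ^ l) u) =
      (translation z ^ (k + l)) u := fun k l u => by rw [zpow_add]; rfl
  have P₁ : ∀ k : ℤ, P ((translation z ^ k) α) := fun k => Or.inr (Or.inr ⟨k, hTapp k α⟩)
  have P₂ : ∀ k : ℤ, P (z 0 ◃ (translation z ^ k) α) := fun k => Or.inr (Or.inl ⟨k, (hz k α).symm⟩)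
  have Pz : ∀ i, P (z i) := fun i => Or.inl ⟨i, rfl⟩
  have hPz : ∀ k u, P u → P (z k ◃ u) := by
    rintro k _ (⟨i, rfl⟩ | ⟨l, rfl⟩ | ⟨l, rfl⟩)
    · rw [h.dihedral]
      exact Pz _
    · convert P₁ (l - k) using 1
      rw [hz k, hz l, hζT l, hTT, show k + -l = -(l - k) by ring, ← hζT, hX]
    · convert P₂ (k + l) using 1
      rw [hz k, ← hTapp, hTT]
  have hPT : ∀ (k : ℤ) u, P u → P ((translation z ^ k) u) := fun k u hu => by
    rw [hTapp]
    exact hPz _ _ (hPz _ _ hu)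
  have hPα : ∀ u, P u → P (α ◃ u) := by
    rintro _ (⟨i, rfl⟩ | ⟨l, rfl⟩ | ⟨l, rfl⟩)
    · obtain ⟨k, rfl | rfl⟩ := Int.even_or_odd' i
      · rw [h.act_z_even hX hac]
        exact Pz _
      rcases Int.even_or_odd' w with ⟨v, hv | hv⟩
      · rcases Int.even_or_odd' q with ⟨s, hs | hs⟩
        · exfalso
          rw [hv, hs] at hac
          have : 2 * (c * s - a * v) = 1 := by linarith
          omega
        -- With `w` even and `q` odd, no base point is odd; but `α ◃ z 0 = z (-q)` is, so every odd
        -- term is a translate of it.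
        · have e : z (2 * k + 1) = (translation z ^ (-(k + s + 1))) (α ◃ z 0) := by
            rw [h.act_zero, h.dihedral.translation_zpow_apply hX, hs]
            congr 1
            ring
          rw [e, hσT, hX]
          exact hPT _ _ (Pz 0)
      · rw [show 2 * k + 1 = -w + 2 * (k + v + 1) by rw [hv]; ring, h.act_z_neg_w hX hac]
        exact Pz _
    · rw [hz, hζT, hσT, Shelf.self_distrib, hα, h.act_zero]
      exact hPT _ _ (Or.inr (Or.inl ⟨-q, rfl⟩))
    · rw [← hTapp, hσT, hα]
      exact P₁ _
  refine hgen P ?_ Pz ?_ v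
  · simpa using P₁ 0
  · rintro _ u (⟨i, rfl⟩ | ⟨l, rfl⟩ | ⟨l, rfl⟩) hu
    · exact hPz _ _ hu
    -- The action of `z l ◃ α` is that of `α` conjugated by that of `z l`.
    · rw [← hX (z l) u, ← Shelf.self_distrib]
      exact hPz _ _ (hPα _ (hPz _ _ hu))
    · rw [← hX (z 0) u, ← Shelf.self_distrib, ← hX (z l) (z 0 ◃ u), ← Shelf.self_distrib]
      exact hPz _ _ (hPz _ _ (hPα _ (hPz _ _ (hPz _ _ hu))))

end IsMontesinosSystem

theorem Int.isCoprime_of_mul_sub_mul_eq_one {a c q w : ℤ} (hac : c * q - a * w = 1) :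
    IsCoprime c w := ⟨q, -a, by linarith⟩

/-- A quandle that is generated by a system and maps to the model is isomorphic to the model. -/
theorem IsMontesinosSystem.bijective {X : Type} [Quandle X] (hX : Rack.IsInvolutory X) {q W : ℕ}
    {w a c : ℤ} {α : X} {z : ℤ → X} (h : IsMontesinosSystem q w α z) (hW : W = w.natAbs)
    (hac : c * q - a * w = 1)
    (hgen : ∀ P : X → Prop, P α → (∀ i, P (z i)) → (∀ x y, P x → P y → P (x ◃ y)) → ∀ x, P x)
    [Fact ((W : ℤ) ∣ c * q - 1)] (f : X → MontesinosModel q W c)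
    (hf : ∀ x y, f (x ◃ y) = f x ◃ f y) (hfα : f α = MontesinosModel.a 0)
    (hfz : ∀ i, f (z i) = MontesinosModel.z i) : Function.Bijective f := by
  have hWw : ∀ n : ℤ, (W : ℤ) ∣ n ↔ w ∣ n := fun n => by rw [hW, Int.natAbs_dvd]
  -- The two families of conjugates of `α` go to odd and even indices, so they stay disjoint modulo
  -- `2 * W`.
  have f₁ : ∀ k, f (z k ◃ α) = MontesinosModel.a (-1 - 2 * c * k) := fun k => by
    rw [hf, hfz, hfα]
    exact (MontesinosModel.act_z_a _ _).trans (by rw [sub_zero])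
  have f₂ : ∀ k, f (z 0 ◃ (z k ◃ α)) = MontesinosModel.a (2 * c * k) := fun k => by
    rw [hf, f₁, hfz]
    refine (MontesinosModel.act_z_a _ _).trans (congrArg MontesinosModel.a ?_)
    ring
  have hcw := Int.isCoprime_of_mul_sub_mul_eq_one hac
  have cancel : ∀ i j : ℤ, ((2 * W : ℕ) : ℤ) ∣ 2 * c * (j - i) → w ∣ j - i := by
    intro i j hij
    push_cast at hij
    rw [mul_assoc, mul_dvd_mul_iff_left two_ne_zero, hWw] at hij
    exact hcw.symm.dvd_of_dvd_mul_left hij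
  have parity : ∀ i j : ℤ, ¬ ((2 * W : ℕ) : ℤ) ∣ 2 * c * j - (-1 - 2 * c * i) := by
    rintro i j ⟨m, hm⟩
    push_cast at hm
    have : 2 * (W * m - c * j - c * i) = 1 := by linarith
    omega
  have parity' : ∀ i j : ℤ, ¬ ((2 * W : ℕ) : ℤ) ∣ (-1 - 2 * c * i) - 2 * c * j :=
    fun i j hij => parity i j (by rw [← dvd_neg, neg_sub]; exact hij)
  constructor
  · intro u v huv
    rcases h.exhaustion hX hac hgen u with ⟨i, rfl⟩ | ⟨i, rfl⟩ | ⟨i, rfl⟩ <;>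
      rcases h.exhaustion hX hac hgen v with ⟨j, rfl⟩ | ⟨j, rfl⟩ | ⟨j, rfl⟩ <;>
      simp only [hfz, f₁, f₂] at huv
    · rw [MontesinosModel.z_eq_z] at huv
      refine h.z_eq_of_dvd hX hac ?_
      push_cast at huv
      exact (mul_dvd_mul_left _ ((hWw _).1 dvd_rfl)).trans huv
    · exact (MontesinosModel.z_ne_a huv).elim
    · exact (MontesinosModel.z_ne_a huv).elim
    · exact (MontesinosModel.z_ne_a huv.symm).elim
    · rw [MontesinosModel.a_eq_a] at huv
      refine h.act_z_base_eq_of_dvd hX (cancel i j ?_)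
      rwa [show 2 * c * (j - i) = -(-1 - 2 * c * j - (-1 - 2 * c * i)) by ring, dvd_neg]
    · exact (parity _ _ (MontesinosModel.a_eq_a.1 huv)).elim
    · exact (MontesinosModel.z_ne_a huv.symm).elim
    · exact (parity' _ _ (MontesinosModel.a_eq_a.1 huv)).elim
    · rw [MontesinosModel.a_eq_a] at huv
      rw [h.act_z_base_eq_of_dvd hX (cancel i j ?_)]
      convert huv using 1
      ring
  · have hdvd : ∀ m : ℤ, ((2 * W : ℕ) : ℤ) ∣ 2 * m * (c * q - 1) := fun m => by
      push_cast
      rw [mul_assoc]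
      exact mul_dvd_mul_left _ (Dvd.dvd.mul_left Fact.out _)
    intro y
    refine MontesinosModel.rec_int (fun i => ⟨z i, hfz i⟩) (fun k => ?_) y
    obtain ⟨m, rfl | rfl⟩ := Int.even_or_odd' k
    -- `q` undoes the factor `c` modulo `W`, hence `2 * c * q * m` is `2 * m` modulo `2 * W`.
    · refine ⟨_, (f₂ (q * m)).trans (MontesinosModel.a_eq_a.2 ?_)⟩
      convert hdvd (-m) using 1
      ring
    · refine ⟨_, (f₁ (q * (-m - 1))).trans (MontesinosModel.a_eq_a.2 ?_)⟩
      convert hdvd (-m - 1) using 1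
      ring

/-! ### Automorphisms of the model -/

theorem Equiv.Perm.apply_inv_apply {α : Type*} (f : Equiv.Perm α) (x : α) : f (f⁻¹ x) = x :=
  f.apply_symm_apply x

theorem Equiv.Perm.inv_apply_apply {α : Type*} (f : Equiv.Perm α) (x : α) : f⁻¹ (f x) = x :=
  f.symm_apply_apply x

/-- The image of an element under an automorphism acts by the conjugate permutation. -/
theorem quandleAut_act' {X : Type} [Quandle X] (φ : quandleAut X) (x : X) :
    Rack.act' (φ.1 x) = φ.1 * Rack.act' x * φ.1⁻¹ := by
  ext y
  change φ.1 x ◃ y = φ.1 (x ◃ φ.1⁻¹ y)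
  rw [φ.2, Equiv.Perm.apply_inv_apply]

/-- Isomorphic quandles have equivalent automorphism groups. -/
theorem nonempty_quandleAut_equiv {X Y : Type} [Quandle X] [Quandle Y] (f : X ≃ Y)
    (hf : ∀ x y, f (x ◃ y) = f x ◃ f y) : Nonempty (quandleAut X ≃ quandleAut Y) := by
  have hf' : ∀ x y, f.symm (x ◃ y) = f.symm x ◃ f.symm y := fun x y => by
    rw [f.symm_apply_eq, hf, f.apply_symm_apply, f.apply_symm_apply]
  refine ⟨f.permCongr.subtypeEquiv fun φ => ⟨fun h x y => ?_, fun h x y => ?_⟩⟩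
  · change f (φ (f.symm (x ◃ y))) = f (φ (f.symm x)) ◃ f (φ (f.symm y))
    rw [hf', h, hf]
  · have := h (f x) (f y)
    change f (φ (f.symm (f x ◃ f y))) = f (φ (f.symm (f x))) ◃ f (φ (f.symm (f y))) at this
    rw [← hf, ← hf, f.symm_apply_apply, f.symm_apply_apply, f.symm_apply_apply] at this
    exact f.injective this

namespace MontesinosModel

variable {q W : ℕ} {c : ℤ} [hc : Fact ((W : ℤ) ∣ c * q - 1)]

theorem isDihedralSeq_z : IsDihedralSeq (z : ℤ → MontesinosModel q W c) := act_z_z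

theorem isDihedralSeq_a : IsDihedralSeq (a : ℤ → MontesinosModel q W c) := act_a_a

theorem exists_act_a (x : MontesinosModel q W c) (k : ℤ) : ∃ l, x ◃ a k = a l :=
  rec_int (fun i => ⟨_, act_z_a i k⟩) (fun i => ⟨_, act_a_a k i⟩) x

theorem quandleAut_ext {φ ψ : quandleAut (MontesinosModel q W c)} (h₀ : φ.1 (z 0) = ψ.1 (z 0))
    (h₁ : φ.1 (z 1) = ψ.1 (z 1)) (ha : φ.1 (a 0) = ψ.1 (a 0)) : φ = ψ := by
  have closed : ∀ x y, φ.1 x = ψ.1 x → φ.1 y = ψ.1 y → φ.1 (x ◃ y) = ψ.1 (x ◃ y) :=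
    fun x y hx hy => by rw [φ.2, ψ.2, hx, hy]
  refine Subtype.ext (Equiv.ext fun x => rec_int (fun i => ?_) (fun k => ?_) x)
  · exact Int.mem_of_reflection_closed (I := {i | φ.1 (z i) = ψ.1 (z i)}) (p := 1) (q := 1)
      isCoprime_one_left h₀ h₁ h₁ (fun i hi j hj => by
        have := closed _ _ hj hi
        rwa [isDihedralSeq_z] at this) i
  · have hneg : φ.1 (a (-1)) = ψ.1 (a (-1)) := by
      have e : (z 0 : MontesinosModel q W c) ◃ a 0 = a (-1) :=
        (act_z_a 0 0).trans (congrArg a (by ring))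
      rw [← e]
      exact closed _ _ h₀ ha
    exact Int.mem_of_reflection_closed (I := {k | φ.1 (a k) = ψ.1 (a k)}) (p := -1) (q := -1)
      isCoprime_one_left.neg_left ha hneg hneg (fun i hi j hj => by
        have := closed _ _ hj hi
        rwa [isDihedralSeq_a] at this) k

/-- The `a k` form one orbit of the inner actions, and every action preserves the small summand, so
one value decides. -/
theorem exists_apply_a_of_exists {φ : quandleAut (MontesinosModel q W c)} {k : ℤ}
    (hk : ∃ l, φ.1 (a k) = a l) (j : ℤ) : ∃ l, φ.1 (a j) = a l := by
  have step : ∀ x i, (∃ l, φ.1 (a i) = a l) → ∃ l, φ.1 (x ◃ a i) = a l := by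
    rintro x i ⟨l, hl⟩
    rw [φ.2, hl]
    exact exists_act_a _ _
  have refl : ∀ i m, (∃ l, φ.1 (a i) = a l) → ∃ l, φ.1 (a (2 * m - i)) = a l := by
    intro i m hi
    rw [← isDihedralSeq_a]
    exact step _ _ hi
  obtain ⟨m, hm | hm⟩ := Int.even_or_odd' (j - k)
  · have := refl _ m (refl k 0 hk)
    rwa [show 2 * m - (2 * 0 - k) = j by linarith] at this
  · have e : (z 0 : MontesinosModel q W c) ◃ a k = a (-1 - k) :=
      (act_z_a 0 k).trans (congrArg a (by ring))
    have h := step (z 0) k hk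
    rw [e] at h
    have := refl _ m h
    rwa [show 2 * m - (-1 - k) = j by linarith] at this

/-- The automorphisms that preserve the small dihedral quandle. -/
def smallStabilizer (q W : ℕ) (c : ℤ) [Fact ((W : ℤ) ∣ c * q - 1)] :
    Subgroup (quandleAut (MontesinosModel q W c)) where
  carrier := {φ | ∀ j, ∃ l, φ.1 (a j) = a l}
  mul_mem' := fun {φ ψ} hφ hψ j => by
    obtain ⟨k, hk⟩ := hψ j
    obtain ⟨l, hl⟩ := hφ k
    exact ⟨l, by
      change φ.1 (ψ.1 (a j)) = a l
      rw [hk, hl]⟩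
  one_mem' := fun j => ⟨j, rfl⟩
  inv_mem' := fun {φ} hφ => by
    obtain ⟨k, hk⟩ := hφ 0
    refine exists_apply_a_of_exists (k := k) ⟨0, ?_⟩
    change φ.1⁻¹ (a k) = a 0
    rw [← hk, Equiv.Perm.inv_apply_apply]

theorem mem_smallStabilizer {φ : quandleAut (MontesinosModel q W c)} {k : ℤ}
    (hk : ∃ l, φ.1 (a k) = a l) : φ ∈ smallStabilizer q W c :=
  exists_apply_a_of_exists hk

theorem exists_apply_z {φ : quandleAut (MontesinosModel q W c)}
    (hφ : φ ∈ smallStabilizer q W c) (i : ℤ) : ∃ j, φ.1 (z i) = z j := by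
  suffices h : ∀ y, φ.1 (z i) = y → ∃ j, y = z j from h _ rfl
  intro y
  refine rec_int (fun j _ => ⟨j, rfl⟩) (fun k hk => ?_) y
  obtain ⟨l, hl⟩ := (smallStabilizer q W c).inv_mem hφ k
  change φ.1⁻¹ (a k) = a l at hl
  rw [← hk, Equiv.Perm.inv_apply_apply] at hl
  exact (z_ne_a hl).elim

theorem exists_parameters {φ : quandleAut (MontesinosModel q W c)}
    (hφ : φ ∈ smallStabilizer q W c) :
    ∃ x : ZMod (2 * W) × ZMod (2 * q * W) × (ZMod (2 * q * W))ˣ,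
      φ.1 (a 0) = Sum.inr x.1 ∧ φ.1 (z 0) = Sum.inl x.2.1 ∧
        φ.1 (z 1) = Sum.inl (x.2.1 + x.2.2.1) := by
  obtain ⟨k, hk⟩ := hφ 0
  obtain ⟨s, hs⟩ := exists_apply_z hφ 0
  obtain ⟨t, ht⟩ := exists_apply_z hφ 1
  have affine : ∀ i, φ.1 (z i) = z (s + i * (t - s)) := by
    refine Int.mem_of_reflection_closed (I := {i | φ.1 (z i) = z (s + i * (t - s))})
      (p := 1) (q := 1) isCoprime_one_left ?_ ?_ ?_ ?_
    · simpa using hs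
    · simpa using ht
    · simpa using ht
    · intro i hi j hj
      simp only [Set.mem_ofPred_eq] at hi hj ⊢
      rw [← isDihedralSeq_z, φ.2, hi, hj, isDihedralSeq_z]
      congr 1
      ring
  -- The preimage `z n` of `z (s + 1)` provides the inverse `n` of the slope `t - s`.
  obtain ⟨n, hn⟩ := exists_apply_z ((smallStabilizer q W c).inv_mem hφ) (s + 1)
  change φ.1⁻¹ (z (s + 1)) = z n at hn
  have hunit : IsUnit ((t - s : ℤ) : ZMod (2 * q * W)) := by
    rw [Equiv.Perm.inv_eq_iff_eq, affine, z_eq_z, ← ZMod.intCast_eq_intCast_iff_dvd_sub] at hn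
    refine IsUnit.of_mul_eq_one (n : ZMod (2 * q * W)) ?_
    push_cast at hn ⊢
    linear_combination -hn
  obtain ⟨u, hu⟩ := hunit
  refine ⟨(k, s, u), hk, hs, ?_⟩
  rw [ht, hu]
  change Sum.inl _ = Sum.inl _
  congr 1
  push_cast
  ring

theorem card_smallStabilizer_le [NeZero q] [NeZero W] :
    Nat.card (smallStabilizer q W c) ≤ 2 * W * (2 * q * W * Nat.totient (2 * q * W)) := by
  choose F hFa hF₀ hF₁ using fun φ : smallStabilizer q W c => exists_parameters φ.2
  have hinj : Function.Injective F := by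
    intro φ ψ h
    refine Subtype.ext (quandleAut_ext ?_ ?_ ?_)
    · rw [hF₀, hF₀, h]
    · rw [hF₁, hF₁, h]
    · rw [hFa, hFa, h]
  refine (Nat.card_le_card_of_injective F hinj).trans_eq ?_
  rw [Nat.card_prod, Nat.card_prod, Nat.card_zmod, Nat.card_zmod, Nat.card_eq_fintype_card,
    ZMod.card_units_eq_totient]

/-- An invariant with three values that separates the orbits of the inner automorphisms. -/
def orbitClass [NeZero W] : MontesinosModel q W c → Option (ZMod 2)
  | Sum.inl i => some (ZMod.castHom ⟨q * W, by ring⟩ (ZMod 2) i)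
  | Sum.inr _ => none

theorem inv_mul_mem_smallStabilizer [NeZero W] {φ ψ : quandleAut (MontesinosModel q W c)}
    (h : orbitClass (φ.1 (a 0)) = orbitClass (ψ.1 (a 0))) :
    ψ⁻¹ * φ ∈ smallStabilizer q W c := by
  suffices H : ∀ x y, φ.1 (a 0) = x → ψ.1 (a 0) = y → ψ⁻¹ * φ ∈ smallStabilizer q W c from
    H _ _ rfl rfl
  intro x y
  refine rec_int (fun i => ?_) (fun i => ?_) x <;> refine rec_int (fun j => ?_) (fun j => ?_) y <;>
    intro hx hy <;> rw [hx, hy] at h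
  · simp only [orbitClass, z, Option.some.injEq, map_intCast] at h
    rw [ZMod.intCast_eq_intCast_iff_dvd_sub] at h
    obtain ⟨m, hm⟩ := h
    push_cast at hm
    -- Indices of equal parity are exchanged by the reflection in their midpoint `i + m`; pulled
    -- back by `ψ`, this keeps `a 0` in the small summand.
    have e : (z i : MontesinosModel q W c) = z (i + m) ◃ z j := by
      rw [isDihedralSeq_z]
      congr 1
      linarith
    refine mem_smallStabilizer (k := 0) ?_
    change ∃ l, ψ.1⁻¹ (φ.1 (a 0)) = a l
    rw [hx, e]
    have h := (ψ⁻¹).2 (z (i + m)) (z j)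
    change ψ.1⁻¹ _ = ψ.1⁻¹ _ ◃ ψ.1⁻¹ _ at h
    rw [h, ← hy, Equiv.Perm.inv_apply_apply]
    exact exists_act_a _ _
  · simp [orbitClass, z, a] at h
  · simp [orbitClass, z, a] at h
  · exact (smallStabilizer q W c).mul_mem
      ((smallStabilizer q W c).inv_mem (mem_smallStabilizer ⟨_, hy⟩)) (mem_smallStabilizer ⟨_, hx⟩)

theorem index_smallStabilizer_le [NeZero W] : (smallStabilizer q W c).index ≤ 3 := by
  let F : quandleAut (MontesinosModel q W c) ⧸ smallStabilizer q W c → Option (ZMod 2) :=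
    fun g => orbitClass (g.out.1 (a 0))
  have hF : Function.Injective F := by
    intro g h hgh
    have := inv_mul_mem_smallStabilizer hgh.symm
    rw [← QuotientGroup.out_eq' g, ← QuotientGroup.out_eq' h]
    exact QuotientGroup.eq.2 this
  refine (Nat.card_le_card_of_injective F hF).trans_eq ?_
  rw [Nat.card_eq_fintype_card, Fintype.card_option, ZMod.card]

/-- `a 0` and `a (W * n)` act alike on the large summand, and `2 * W * n` vanishes in the small one.
-/
theorem translation_a_zpow (n : ℤ) :
    IsDihedralSeq.translation (a : ℤ → MontesinosModel q W c) ^ (W * n) = 1 := by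
  obtain ⟨m, hm⟩ := hc.out
  ext x
  refine rec_int (fun i => ?_) (fun i => ?_) x
  · rw [isDihedralSeq_a.translation_zpow isInvolutory]
    change act (a 0) (act (a (W * n)) (z i)) = z i
    rw [act_a_z, act_a_z, z_eq_z]
    refine ⟨-n - m * (1 + 2 * (W * n) + 2 * c * i), ?_⟩
    push_cast
    linear_combination (-(2 * q * (1 + 2 * (W * n) + 2 * c * i)) : ℤ) * hm
  · rw [isDihedralSeq_a.translation_zpow_apply isInvolutory, Equiv.Perm.one_apply, a_eq_a]
    exact ⟨n, by push_cast; ring⟩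

/-- If `a 0` went to `z s`, some `a j` would go to `z (s + 2)`. The translation they span would have
trivial `W`-th power, yet it moves `z s` to `z (s - 4 * W)`; so `q` would divide `2`. -/
theorem smallStabilizer_eq_top [NeZero W] (hq : 2 < q) : smallStabilizer q W c = ⊤ := by
  refine (Subgroup.eq_top_iff' _).2 fun φ => ?_
  suffices H : ∀ x, φ.1 (a 0) = x → φ ∈ smallStabilizer q W c from H _ rfl
  intro x
  refine rec_int (fun s hs => ?_) (fun k hk => mem_smallStabilizer ⟨k, hk⟩) x
  exfalso
  obtain ⟨j, hj⟩ := exists_act_a (φ.1⁻¹ (z (s + 1))) (0 : ℤ)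
  have hs' : φ.1 (a j) = z (s + 2) := by
    rw [← hj, φ.2, Equiv.Perm.apply_inv_apply, hs, isDihedralSeq_z]
    congr 1
    ring
  have hz := (isDihedralSeq_z (q := q) (W := W) (c := c)).comp_affine 2 s
  have hconj : IsDihedralSeq.translation (fun i => (z (2 * i + s) : MontesinosModel q W c)) =
      φ.1 * IsDihedralSeq.translation a ^ j * φ.1⁻¹ := by
    rw [isDihedralSeq_a.translation_zpow isInvolutory, IsDihedralSeq.translation,
      show 2 * 0 + s = s by ring, show 2 * 1 + s = s + 2 by ring, ← hs, ← hs', quandleAut_act',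
      quandleAut_act']
    group
  have h := hz.translation_zpow_apply isInvolutory W 0
  rw [hconj, conj_zpow, ← zpow_mul, mul_comm j, translation_a_zpow, mul_one, mul_inv_cancel,
    Equiv.Perm.one_apply, z_eq_z] at h
  obtain ⟨m, hm⟩ := h
  push_cast at hm
  have hW : (W : ℤ) ≠ 0 := Nat.cast_ne_zero.2 (NeZero.ne W)
  have hqm : (q : ℤ) ∣ 2 := by
    refine ⟨-m, mul_left_cancel₀ hW ?_⟩
    linarith
  have := Int.le_of_dvd two_pos hqm
  omega

theorem card_quandleAut_le_of_eq_two [NeZero W] (hq : q = 2) :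
    Nat.card (quandleAut (MontesinosModel q W c)) ≤ 24 * W ^ 2 * Nat.totient (4 * W) := by
  subst hq
  have h₁ := card_smallStabilizer_le (q := 2) (W := W) (c := c)
  have h₂ := index_smallStabilizer_le (q := 2) (W := W) (c := c)
  calc _ = _ := (Subgroup.card_mul_index (smallStabilizer 2 W c)).symm
    _ ≤ _ := Nat.mul_le_mul h₁ h₂
    _ = _ := by
      norm_num
      ring

theorem card_quandleAut_le_of_two_lt [NeZero W] (hq : 2 < q) :
    Nat.card (quandleAut (MontesinosModel q W c)) ≤
      4 * q * W ^ 2 * Nat.totient (2 * q * W) := by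
  have : NeZero q := ⟨by omega⟩
  have h := card_smallStabilizer_le (q := q) (W := W) (c := c)
  rw [smallStabilizer_eq_top hq, Subgroup.card_top] at h
  exact h.trans_eq (by ring)

end MontesinosModel

theorem mainTheorem6 (p q : ℕ) (hp : 0 < p) (hpq : p < q) (hcop : Nat.Coprime p q)
    (e w : ℤ) (hw : w = (e - 1) * q - p)
    (t₁ t₂ t₃ : RationalTangle) (ht₁ : t₁.HasFraction 1 2) (ht₂ : t₂.HasFraction 1 2)
    (ht₃ : t₃.HasFraction p q) :
    Finite (quandleAut (montesinosDiagram t₁ t₂ t₃ e).InvolutoryQuandle) ∧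
    (q = 2 → Nat.card (quandleAut (montesinosDiagram t₁ t₂ t₃ e).InvolutoryQuandle) ≤
      24 * w.natAbs ^ 2 * Nat.totient (4 * w.natAbs)) ∧
    (2 < q → Nat.card (quandleAut (montesinosDiagram t₁ t₂ t₃ e).InvolutoryQuandle) ≤
      4 * q * w.natAbs ^ 2 * Nat.totient (2 * q * w.natAbs)) := by
  have hpq' : IsCoprime (p : ℤ) q := Nat.isCoprime_iff_coprime.2 hcop
  -- `w = 0` would make `q` divide `p`, against `0 < p < q`.
  have hw0 : w ≠ 0 := by
    intro h
    have hdvd : (q : ℤ) ∣ p := ⟨e - 1, by linarith⟩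
    exact absurd (Nat.le_of_dvd hp (Int.natCast_dvd_natCast.1 hdvd)) (by omega)
  obtain ⟨a, c, hac⟩ : ∃ a c : ℤ, c * q - a * w = 1 := by
    obtain ⟨u, v, huv⟩ := hpq'
    -- Substitute `p = (e - 1) * q - w` in `u * p + v * q = 1`.
    exact ⟨u, v + u * (e - 1), by rw [hw]; linear_combination huv⟩
  have : NeZero q := ⟨by omega⟩
  have : NeZero w.natAbs := ⟨Int.natAbs_ne_zero.2 hw0⟩
  have : Fact ((w.natAbs : ℤ) ∣ c * q - 1) := ⟨Int.natAbs_dvd.2 ⟨a, by linarith⟩⟩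
  obtain ⟨α, z, hsys, hgen, huniv⟩ := exists_isMontesinosSystem hpq' hw
    (ht₁.hasLabelling isCoprime_one_left) (ht₂.hasLabelling isCoprime_one_left)
    (ht₃.hasLabelling hpq')
  obtain ⟨f, hf, hfα, hfz⟩ := huniv (MontesinosModel q w.natAbs c) MontesinosModel.isInvolutory _ _
    (MontesinosModel.isMontesinosSystem (Int.natAbs_dvd.2 dvd_rfl))
  have hbij := hsys.bijective (PresentedInvQuandle.isInvolutory _) rfl hac hgen f hf hfα hfz
  obtain ⟨E⟩ := nonempty_quandleAut_equiv (Equiv.ofBijective f hbij) hf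
  rw [Nat.card_congr E]
  exact ⟨.of_equiv _ E.symm, MontesinosModel.card_quandleAut_le_of_eq_two,
    MontesinosModel.card_quandleAut_le_of_two_lt⟩
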